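/- Let $d\ge 1$, let $H\le \mathrm{GL}(\mathbb R^d)$ be a closed subgroup with left Haar measure $\mu_H$ (written $dh$), and let $\xi_0\in\mathbb R^d$ be such that the dual orbit $\mathcal O=H^T\xi_0=\{h^T\xi_0 : h\in H\}$ is open with Lebesgue-null complement and the isotropy group $\{h\in H: h^T\xi_0=\xi_0\}$ is compact. Let $(h_i)_{i\in I}$ be a well-spread family in $H$, i.e. there is a neighbourhood $V$ of the identity such that $h_iV\cap h_jV=\emptyset$ for all $i\ne j$, and there is a relatively compact neighbourhood $W$ of the identity with $H=\bigcup_i h_iW$. Let $U\subset H$ be precompact and measurable with $H=\bigcup_{i\in I}h_iU$. Let $\psi\in\mathcal S(\mathbb R^d)\setminus\{0\}$ with $\widehat\psi\in C_c^\infty(\mathcal O)$, where $\widehat\psi(\xi)=\int\psi(x)e^{-2\pi i\langle x,\xi\rangle}dx$. Put $Q=U^{-T}\{\widehat\psi\neq0\}=\{h^{-T}\xi: h\in U,\ \widehat\psi(\xi)\ne0\}$. For $x\in\mathbb R^d$, $h\in H$ let $(W_\psi\psi)(x,h)=\int_{\mathbb R^d}\psi(y)\,\overline{|\det h|^{-1/2}\psi(h^{-1}(y-x))}\,dy$,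 let $G=\mathbb R^d\rtimes H$ carry the left Haar measure $dx\,dh/|\det h|$, and put $C_\psi=\|W_\psi\psi\|_{L^2(G)}^2/\|\psi\|_{L^2(\mathbb R^d)}^2$. Then: 1. $I$ is countably infinite. For every enumeration $(i_n)_{n\in\mathbb N}$ of $I$, the sets $U_{i_n}=h_{i_n}U\setminus\bigcup_{m<n}h_{i_m}U$ form a partition of $H$ into measurable sets with $U_i\subset h_iU$ for all $i\in I$. 2. $Q$ is open and precompact with $\overline Q\subset\mathcal O$, and $\mathcal O=\bigcup_{i\in I}h_i^{-T}Q$; thus $\mathcal Q=(h_i^{-T}Q)_{i\in I}$ is a covering of $\mathcal O$ induced by $H$. 3. $W_\psi\psi\in L^2(G)$ and $C_\psi>0$. For every partition $(U_i)_{i\in I}$ of $H$ into measurable (possibly empty) sets with $U_i\subset h_iU$ for all $i$ (in particular for those in 1), the functions $$\varphi_i(\xi)=\frac1{C_\psi}\int_{U_i}|\widehat\psi(h^T\xi)|^2\,dh\qquad(\xi\in\mathbb R^d)$$ form a bounded admissible partition of unity (BAPU) on $\mathcal O$ subordinate to $\mathcal Q$: the covering $\mathcal Q$ of $\mathcal O$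 is admissible, i.e. $\sup_{i\in I}|\{j\in I: h_j^{-T}Q\cap h_i^{-T}Q\neq\emptyset\}|<\infty$; $\varphi_i\in C_c^\infty(\mathcal O)$ for all $i$; $\sum_{i\in I}\varphi_i(\xi)=1$ for all $\xi\in\mathcal O$; $\varphi_i=0$ on $\mathcal O\setminus h_i^{-T}Q$ for all $i$; and $\sup_{i\in I}\|\mathcal F^{-1}\varphi_i\|_{L^1(\mathbb R^d)}<\infty$. -/

import Mathlib

open MeasureTheory Topology Matrix
open scoped FourierTransform SchwartzMap ContDiff Pointwise

noncomputable section

/-! ### Well-spread families in a topological group -/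

/-- `(g j)` is `U`-dense: the translates `g j U` cover the group. -/
def IsUDense {G J : Type*} [Group G] (g : J → G) (U : Set G) : Prop :=
  ⋃ j, g j • U = Set.univ

/-- `(g j)` is `U`-discrete: the translates `g j U` for distinct indices are disjoint. -/
def IsUDiscrete {G J : Type*} [Group G] (g : J → G) (U : Set G) : Prop :=
  ∀ j j', j ≠ j' → Disjoint (g j • U) (g j' • U)

/-- Separated: `V`-discrete for some neighbourhood `V` of the identity. -/
def IsSeparatedFamily {G J : Type*} [Group G] [TopologicalSpace G] (g : J → G) : Prop :=
  ∃ V ∈ 𝓝 (1 : G), IsUDiscrete g V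

/-- Well-spread: separated, and `U`-dense for some relatively compact neighbourhood `U`
of the identity. -/
def IsWellSpread {G J : Type*} [Group G] [TopologicalSpace G] (g : J → G) : Prop :=
  IsSeparatedFamily g ∧ ∃ U ∈ 𝓝 (1 : G), IsCompact (closure U) ∧ IsUDense g U

/-- `(U i)` is a partition of the measurable space `X` into measurable sets
(empty pieces are allowed). -/
structure IsMeasurablePartition {X I : Type*} [MeasurableSpace X] (U : I → Set X) : Prop where
  measurableSet : ∀ i, MeasurableSet (U i)
  disjoint : ∀ i j, i ≠ j → Disjoint (U i) (U j)
  iUnion_eq : ⋃ i, U i = Set.univ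

/-! ### Admissible coverings and bounded admissible partitions of unity -/

/-- `f ∈ 𝓓(O) = C_c^∞(O)` (complex valued, extended by zero to the whole space). -/
structure IsTestFunctionOn {d : ℕ} (O : Set (EuclideanSpace ℝ (Fin d)))
    (f : EuclideanSpace ℝ (Fin d) → ℂ) : Prop where
  contDiff : ContDiff ℝ ∞ f
  hasCompactSupport : HasCompactSupport f
  tsupport_subset : tsupport f ⊆ O

/-- `Q` is an admissible covering of the nonempty set `X`: it covers `X`, and the
index clusters `{j | Q j ∩ Q i ≠ ∅}` have uniformly bounded cardinality. -/
structure IsAdmissibleCovering {α I : Type*} (X : Set α) (Q : I → Set α) : Prop where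
  nonempty : X.Nonempty
  iUnion_eq : ⋃ i, Q i = X
  exists_encard_le : ∃ n₀ : ℕ, ∀ i, {j | (Q j ∩ Q i).Nonempty}.encard ≤ n₀

/-- `(φ i)` is a bounded admissible partition of unity on the open set `O`,
subordinate to the admissible covering `Q` of `O`. -/
structure IsBAPU {d : ℕ} {I : Type*} (O : Set (EuclideanSpace ℝ (Fin d)))
    (Q : I → Set (EuclideanSpace ℝ (Fin d)))
    (φ : I → EuclideanSpace ℝ (Fin d) → ℂ) : Prop where
  isOpen : IsOpen O
  isAdmissibleCovering : IsAdmissibleCovering O Q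
  isTestFunctionOn : ∀ i, IsTestFunctionOn O (φ i)
  hasSum_one : ∀ x ∈ O, HasSum (fun i => φ i x) 1
  eq_zero : ∀ i, ∀ x ∈ O \ Q i, φ i x = 0
  bounded : ⨆ i, eLpNorm (𝓕⁻ (φ i)) 1 volume < ⊤

/-! ### The dual action of a matrix group and its orbit -/

/-- The vector `A v`, as an element of Euclidean space. -/
def matAct {d : ℕ} (A : Matrix (Fin d) (Fin d) ℝ) (v : EuclideanSpace ℝ (Fin d)) :
    EuclideanSpace ℝ (Fin d) :=
  WithLp.toLp 2 (A *ᵥ v.ofLp)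

/-- `hᵀ ξ`. Hence `h⁻ᵀ ξ` is `dualAct h⁻¹ ξ`. -/
def dualAct {d : ℕ} (h : GL (Fin d) ℝ) (ξ : EuclideanSpace ℝ (Fin d)) :
    EuclideanSpace ℝ (Fin d) :=
  matAct (h : Matrix (Fin d) (Fin d) ℝ)ᵀ ξ

/-- The dual orbit `Hᵀ ξ₀`. -/
def dualOrbit {d : ℕ} (H : Subgroup (GL (Fin d) ℝ)) (ξ₀ : EuclideanSpace ℝ (Fin d)) :
    Set (EuclideanSpace ℝ (Fin d)) :=
  Set.range fun h : H => dualAct (h : GL (Fin d) ℝ) ξ₀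

/-- The isotropy group of `ξ₀` under the dual action, as a subset of `H`. -/
def dualStabilizer {d : ℕ} (H : Subgroup (GL (Fin d) ℝ)) (ξ₀ : EuclideanSpace ℝ (Fin d)) :
    Set H :=
  {h | dualAct (h : GL (Fin d) ℝ) ξ₀ = ξ₀}

/-- The family of sets `h i⁻ᵀ Q`. -/
def dualTranslates {d : ℕ} {I : Type*} {H : Subgroup (GL (Fin d) ℝ)} (h : I → H)
    (Q : Set (EuclideanSpace ℝ (Fin d))) (i : I) : Set (EuclideanSpace ℝ (Fin d)) :=
  dualAct ((h i : GL (Fin d) ℝ)⁻¹) '' Q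

/-- `(h i⁻ᵀ Q)` is a covering of the dual orbit `Hᵀ ξ₀` induced by `H`. -/
structure IsInducedCovering {d : ℕ} {I : Type*} (H : Subgroup (GL (Fin d) ℝ))
    (ξ₀ : EuclideanSpace ℝ (Fin d)) (h : I → H) (Q : Set (EuclideanSpace ℝ (Fin d))) :
    Prop where
  isWellSpread : IsWellSpread h
  isCompact_closure : IsCompact (closure Q)
  closure_subset : closure Q ⊆ dualOrbit H ξ₀
  iUnion_eq : ⋃ i, dualTranslates h Q i = dualOrbit H ξ₀

/-- The set `U⁻ᵀ (ψ̂⁻¹ (ℂ \ {0}))`. -/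
def frequencySet {d : ℕ} {H : Subgroup (GL (Fin d) ℝ)} (U : Set H)
    (ψ : EuclideanSpace ℝ (Fin d) → ℂ) : Set (EuclideanSpace ℝ (Fin d)) :=
  Set.image2 (fun (h : H) ξ => dualAct ((h : GL (Fin d) ℝ)⁻¹) ξ) U {ξ | 𝓕 ψ ξ ≠ 0}

/-! ### The wavelet transform and the constant `C_ψ` -/

/-- The quasi-regular representation of `ℝᵈ ⋊ H`:
`(π(x, h) f)(y) = |det h|^{-1/2} f (h⁻¹ (y - x))`. -/
def quasiRegular {d : ℕ} (x : EuclideanSpace ℝ (Fin d)) (h : GL (Fin d) ℝ)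
    (f : EuclideanSpace ℝ (Fin d) → ℂ) (y : EuclideanSpace ℝ (Fin d)) : ℂ :=
  ((|(h : Matrix (Fin d) (Fin d) ℝ).det| ^ (-(1 / 2) : ℝ) : ℝ) : ℂ) *
    f (matAct ((h⁻¹ : GL (Fin d) ℝ) : Matrix (Fin d) (Fin d) ℝ) (y - x))

/-- The wavelet transform `(W_g f)(x, h) = ⟨f, π(x, h) g⟩`, the inner product of `L²(ℝᵈ)`
being antilinear in the second entry. The underlying set of `ℝᵈ ⋊ H` is `ℝᵈ × H`. -/
def waveletTransform {d : ℕ} (H : Subgroup (GL (Fin d) ℝ))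
    (g f : EuclideanSpace ℝ (Fin d) → ℂ) (p : EuclideanSpace ℝ (Fin d) × H) : ℂ :=
  ∫ y, f y * star (quasiRegular p.1 (p.2 : GL (Fin d) ℝ) g y)

/-- The left Haar measure `dx dh / |det h|` of `ℝᵈ ⋊ H` belonging to a left Haar measure `μ`
of `H`. -/
def semidirectHaar {d : ℕ} {H : Subgroup (GL (Fin d) ℝ)} [MeasurableSpace H] (μ : Measure H) :
    Measure (EuclideanSpace ℝ (Fin d) × H) :=
  (volume : Measure (EuclideanSpace ℝ (Fin d))).prod
    (μ.withDensity fun h =>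
      ENNReal.ofReal (|((h : GL (Fin d) ℝ) : Matrix (Fin d) (Fin d) ℝ).det|⁻¹))

/-- `C_ψ = ‖W_ψ ψ‖² / ‖ψ‖²` (norms of `L²(ℝᵈ ⋊ H)` and of `L²(ℝᵈ)`). -/
def waveletConst {d : ℕ} {H : Subgroup (GL (Fin d) ℝ)} [MeasurableSpace H] (μ : Measure H)
    (ψ : EuclideanSpace ℝ (Fin d) → ℂ) : ℝ :=
  (∫ p, ‖waveletTransform H ψ ψ p‖ ^ 2 ∂(semidirectHaar μ)) / ∫ y, ‖ψ y‖ ^ 2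

/-- `φ_V(ξ) = ∫_V |ψ̂(hᵀ ξ)|² dh`. -/
def orbitBump {d : ℕ} {H : Subgroup (GL (Fin d) ℝ)} [MeasurableSpace H] (μ : Measure H)
    (ψ : EuclideanSpace ℝ (Fin d) → ℂ) (V : Set H) (ξ : EuclideanSpace ℝ (Fin d)) : ℝ :=
  ∫ h in V, ‖𝓕 ψ (dualAct (h : GL (Fin d) ℝ) ξ)‖ ^ 2 ∂μ

/-- The sets `U_{iₙ} = h_{iₙ} U \ ⋃_{m < n} h_{iₘ} U` for an enumeration `n ↦ iₙ = e n`. -/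
def disjointTranslates {G I : Type*} [Group G] (h : I → G) (U : Set G) (e : ℕ ≃ I) (i : I) :
    Set G :=
  (h i • U) \ ⋃ m : {m : ℕ // m < e.symm i}, h (e m) • U

end

/-! The orbit map h ↦ hᵀξ₀ transfers the geometry of H to the dual orbit. An open orbit is locally
compact, so the open mapping theorem for transitive actions of σ-compact groups makes the orbit map
open. Compactness of the isotropy group then makes it proper (`isCompact_setOf_dualAct_mem`,
`exists_isCompact_of_dualAct_mem`). If two translates of Q meet, h_i⁻¹h_j lies in a fixed compact
set, and packing disjoint translates of equal Haar measure (`IsSeparatedFamily.exists_encard_le`)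
bounds the number of such j.

By Plancherel in x and Tonelli, ‖W_ψψ‖² = ∫ |ψ̂(ξ)|² (∫_H |ψ̂(hᵀξ)|² dh) dξ. Left invariance makes
the inner integral constant on the orbit, so C_ψ is that constant (`waveletConst_eq`). Splitting H
into the pieces U_i therefore gives ∑ φ_i = 1.

Each U_i is relatively compact, so φ_i is smooth by differentiation under the integral and has
compact support in the orbit. The function 𝓕⁻(|ψ̂|² ∘ hᵀ) is an L¹-normalised dilate of 𝓕⁻(|ψ̂|²).
Hence ‖𝓕⁻φ_i‖₁ ≤ C_ψ⁻¹ μ(U_i) ‖𝓕⁻(|ψ̂|²)‖₁, and μ(U_i) ≤ μ(h_iU) = μ(U) does not depend on i. -/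

noncomputable section

/-! ### The dual action -/

section DualAction

variable {d : ℕ}

/-- `ξ ↦ hᵀ ξ` as a continuous linear map. -/
def dualActCLM (h : GL (Fin d) ℝ) : EuclideanSpace ℝ (Fin d) →L[ℝ] EuclideanSpace ℝ (Fin d) :=
  toEuclideanCLM (n := Fin d) (𝕜 := ℝ) (h : Matrix (Fin d) (Fin d) ℝ)ᵀ

@[simp] lemma dualAct_one (ξ : EuclideanSpace ℝ (Fin d)) : dualAct 1 ξ = ξ := by
  simp [dualAct, matAct]

lemma dualAct_mul (a b : GL (Fin d) ℝ) (ξ : EuclideanSpace ℝ (Fin d)) :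
    dualAct (a * b) ξ = dualAct b (dualAct a ξ) := by
  simp [dualAct, matAct, Matrix.transpose_mul, Matrix.mulVec_mulVec]

@[simp] lemma dualAct_inv_dualAct (a : GL (Fin d) ℝ) (ξ : EuclideanSpace ℝ (Fin d)) :
    dualAct a⁻¹ (dualAct a ξ) = ξ := by
  rw [← dualAct_mul, mul_inv_cancel, dualAct_one]

@[simp] lemma dualAct_dualAct_inv (a : GL (Fin d) ℝ) (ξ : EuclideanSpace ℝ (Fin d)) :
    dualAct a (dualAct a⁻¹ ξ) = ξ := by
  rw [← dualAct_mul, inv_mul_cancel, dualAct_one]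

lemma continuous_dualActCLM : Continuous (dualActCLM (d := d)) := by
  have h1 : Continuous (toEuclideanCLM (n := Fin d) (𝕜 := ℝ)) :=
    LinearMap.continuous_of_finiteDimensional
      (toEuclideanCLM (n := Fin d) (𝕜 := ℝ)).toAlgEquiv.toLinearMap
  exact h1.comp (Units.continuous_val.matrix_transpose)

lemma continuous_dualAct :
    Continuous fun p : GL (Fin d) ℝ × EuclideanSpace ℝ (Fin d) => dualAct p.1 p.2 :=
  (continuous_dualActCLM.comp continuous_fst).clm_apply continuous_snd

lemma continuous_dualAct_subgroup (H : Subgroup (GL (Fin d) ℝ)) :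
    Continuous fun p : H × EuclideanSpace ℝ (Fin d) => dualAct (p.1 : GL (Fin d) ℝ) p.2 :=
  continuous_dualAct.comp
    ((continuous_subtype_val.comp continuous_fst).prodMk continuous_snd)

lemma continuous_dualAct_left (H : Subgroup (GL (Fin d) ℝ)) (ξ : EuclideanSpace ℝ (Fin d)) :
    Continuous fun h : H => dualAct (h : GL (Fin d) ℝ) ξ :=
  (continuous_dualAct_subgroup H).comp (continuous_id.prodMk continuous_const)

lemma continuous_dualAct_right (h : GL (Fin d) ℝ) : Continuous (dualAct h) :=
  (dualActCLM h).continuous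

/-- `ξ ↦ hᵀ ξ` as a homeomorphism. -/
def dualActHomeomorph (h : GL (Fin d) ℝ) :
    EuclideanSpace ℝ (Fin d) ≃ₜ EuclideanSpace ℝ (Fin d) where
  toFun := dualAct h
  invFun := dualAct h⁻¹
  left_inv := dualAct_inv_dualAct h
  right_inv := dualAct_dualAct_inv h
  continuous_toFun := continuous_dualAct_right h
  continuous_invFun := continuous_dualAct_right h⁻¹

lemma isOpenMap_dualAct (h : GL (Fin d) ℝ) : IsOpenMap (dualAct h) :=
  (dualActHomeomorph h).isOpenMap

lemma continuous_det_coe (H : Subgroup (GL (Fin d) ℝ)) :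
    Continuous fun h : H => ((h : GL (Fin d) ℝ) : Matrix (Fin d) (Fin d) ℝ).det :=
  (Units.continuous_val.comp continuous_subtype_val).matrix_det

lemma det_coe_ne_zero (h : GL (Fin d) ℝ) : (h : Matrix (Fin d) (Fin d) ℝ).det ≠ 0 :=
  ((Matrix.isUnit_iff_isUnit_det _).1 h.isUnit).ne_zero

/-! ### Topology of closed linear groups -/

instance GL.instSecondCountableTopology : SecondCountableTopology (GL (Fin d) ℝ) :=
  have : SecondCountableTopology (Matrix (Fin d) (Fin d) ℝ) :=
    inferInstanceAs (SecondCountableTopology (Fin d → Fin d → ℝ))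
  have : SecondCountableTopology (Matrix (Fin d) (Fin d) ℝ)ᵐᵒᵖ :=
    MulOpposite.opHomeomorph.symm.isEmbedding.secondCountableTopology
  Units.isEmbedding_embedProduct.secondCountableTopology

instance GL.instLocallyCompactSpace : LocallyCompactSpace (GL (Fin d) ℝ) :=
  have : LocallyCompactSpace (Matrix (Fin d) (Fin d) ℝ) :=
    inferInstanceAs (LocallyCompactSpace (Fin d → Fin d → ℝ))
  inferInstanceAs (LocallyCompactSpace (Matrix (Fin d) (Fin d) ℝ)ˣ)

instance GL.instSecondCountableTopologySubgroup (H : Subgroup (GL (Fin d) ℝ)) :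
    SecondCountableTopology H :=
  TopologicalSpace.Subtype.secondCountableTopology _

lemma locallyCompactSpace_of_isClosed {H : Subgroup (GL (Fin d) ℝ)}
    (hH : IsClosed (H : Set (GL (Fin d) ℝ))) : LocallyCompactSpace H :=
  hH.isClosedEmbedding_subtypeVal.locallyCompactSpace

/-! ### The dual orbit -/

variable {H : Subgroup (GL (Fin d) ℝ)} {ξ₀ : EuclideanSpace ℝ (Fin d)}

lemma mem_dualOrbit_self : ξ₀ ∈ dualOrbit H ξ₀ := ⟨1, by simp⟩

lemma dualAct_mem_dualOrbit (h : H) {ξ : EuclideanSpace ℝ (Fin d)} (hξ : ξ ∈ dualOrbit H ξ₀) :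
    dualAct (h : GL (Fin d) ℝ) ξ ∈ dualOrbit H ξ₀ := by
  obtain ⟨g, rfl⟩ := hξ
  exact ⟨g * h, by simp [dualAct_mul]⟩

lemma exists_dualAct_eq {ξ η : EuclideanSpace ℝ (Fin d)} (hξ : ξ ∈ dualOrbit H ξ₀)
    (hη : η ∈ dualOrbit H ξ₀) : ∃ h : H, dualAct (h : GL (Fin d) ℝ) ξ = η := by
  obtain ⟨a, rfl⟩ := hξ
  obtain ⟨b, rfl⟩ := hη
  exact ⟨a⁻¹ * b, by simp [dualAct_mul]⟩

/-- The left action `h • ξ = h⁻ᵀ ξ` on the dual orbit. -/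
@[reducible] def dualOrbitAction (H : Subgroup (GL (Fin d) ℝ)) (ξ₀ : EuclideanSpace ℝ (Fin d)) :
    MulAction H (dualOrbit H ξ₀) where
  smul h ξ := ⟨dualAct ((h⁻¹ : H) : GL (Fin d) ℝ) ξ, dualAct_mem_dualOrbit h⁻¹ ξ.2⟩
  one_smul ξ := Subtype.ext (by change dualAct _ _ = _; simp)
  mul_smul a b ξ := Subtype.ext (by change dualAct _ _ = dualAct _ (dualAct _ _); simp [dualAct_mul])

/-- The orbit map onto an open dual orbit is open. -/
lemma image_dualAct_mem_nhds (hH : IsClosed (H : Set (GL (Fin d) ℝ)))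
    (hOpen : IsOpen (dualOrbit H ξ₀)) (h : H) {N : Set H} (hN : N ∈ 𝓝 h) :
    (fun g : H => dualAct (g : GL (Fin d) ℝ) ξ₀) '' N ∈ 𝓝 (dualAct (h : GL (Fin d) ℝ) ξ₀) := by
  let _ := dualOrbitAction H ξ₀
  have := locallyCompactSpace_of_isClosed hH
  have : LocallyCompactSpace (dualOrbit H ξ₀) := hOpen.locallyCompactSpace
  have : ContinuousSMul H (dualOrbit H ξ₀) := ⟨by
    refine Continuous.subtype_mk ((continuous_dualAct_subgroup H).comp
      (f := fun p : H × dualOrbit H ξ₀ => (p.1⁻¹, (p.2 : EuclideanSpace ℝ (Fin d)))) ?_) _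
    exact continuous_fst.inv.prodMk (continuous_subtype_val.comp continuous_snd)⟩
  have : MulAction.IsPretransitive H (dualOrbit H ξ₀) := ⟨fun x y => by
    obtain ⟨g, hg⟩ := exists_dualAct_eq x.2 y.2
    exact ⟨g⁻¹, Subtype.ext (by change dualAct _ _ = _; simpa using hg)⟩⟩
  -- H is σ-compact, being locally compact and second countable, and the locally compact orbit is a
  -- Baire space.
  have key := isOpenMap_smul_of_sigmaCompact (G := H) (⟨ξ₀, mem_dualOrbit_self⟩ : dualOrbit H ξ₀)
  -- The left action is by h⁻ᵀ, so its orbit map is the one wanted composed with inversion; hence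
  -- h⁻¹ and N⁻¹.
  have h1 := key.image_mem_nhds (x := h⁻¹) (s := N⁻¹) (continuous_inv.continuousAt.preimage_mem_nhds (by simpa using hN))
  have h2 := hOpen.isOpenMap_subtype_val.image_mem_nhds h1
  rw [Set.image_image] at h2
  have e : ∀ g : H, (((g • (⟨ξ₀, mem_dualOrbit_self⟩ : dualOrbit H ξ₀)) : dualOrbit H ξ₀) :
      EuclideanSpace ℝ (Fin d)) = dualAct ((g⁻¹ : H) : GL (Fin d) ℝ) ξ₀ := fun g => rfl
  simp only [e, inv_inv] at h2
  convert h2 using 1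
  rw [← Set.image_inv_eq_inv, Set.image_image]
  simp

/-- Since the orbit map is open, a compact neighbourhood of h covers a neighbourhood of hᵀξ₀;
finitely many of these cover K. -/
lemma exists_isCompact_subset_image_dualAct (hH : IsClosed (H : Set (GL (Fin d) ℝ)))
    (hOpen : IsOpen (dualOrbit H ξ₀)) {K : Set (EuclideanSpace ℝ (Fin d))} (hK : IsCompact K)
    (hKO : K ⊆ dualOrbit H ξ₀) :
    ∃ F : Set H, IsCompact F ∧ K ⊆ (fun g : H => dualAct (g : GL (Fin d) ℝ) ξ₀) '' F := by
  have := locallyCompactSpace_of_isClosed hH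
  refine hK.induction_on (p := fun S => ∃ F : Set H, IsCompact F ∧
    S ⊆ (fun g : H => dualAct (g : GL (Fin d) ℝ) ξ₀) '' F) ⟨∅, isCompact_empty, by simp⟩ ?_ ?_ ?_
  · rintro s t hst ⟨F, hF, htF⟩
    exact ⟨F, hF, hst.trans htF⟩
  · rintro s t ⟨F, hF, hs⟩ ⟨F', hF', ht⟩
    exact ⟨F ∪ F', hF.union hF', by rw [Set.image_union]; exact Set.union_subset_union hs ht⟩
  · intro x hx
    obtain ⟨h, rfl⟩ := hKO hx
    obtain ⟨N, hN, hNh⟩ := exists_compact_mem_nhds h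
    exact ⟨_, mem_nhdsWithin_of_mem_nhds (image_dualAct_mem_nhds hH hOpen h hNh), N, hN, le_rfl⟩

lemma isCompact_setOf_dualAct_mem (hH : IsClosed (H : Set (GL (Fin d) ℝ)))
    (hOpen : IsOpen (dualOrbit H ξ₀)) (hStab : IsCompact (dualStabilizer H ξ₀))
    {K : Set (EuclideanSpace ℝ (Fin d))} (hK : IsCompact K) (hKO : K ⊆ dualOrbit H ξ₀) :
    IsCompact {h : H | dualAct (h : GL (Fin d) ℝ) ξ₀ ∈ K} := by
  obtain ⟨F, hF, hKF⟩ := exists_isCompact_subset_image_dualAct hH hOpen hK hKO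
  -- If hᵀξ₀ = fᵀξ₀ with f ∈ F, then hf⁻¹ fixes ξ₀, so h = (hf⁻¹)f lies in the compact product of
  -- the stabilizer and F.
  refine (hStab.mul hF).of_isClosed_subset
    (hK.isClosed.preimage (continuous_dualAct_left H ξ₀)) fun h hh => ?_
  obtain ⟨f, hf, hfh⟩ := hKF hh
  refine ⟨h * f⁻¹, ?_, f, hf, by simp⟩
  change dualAct _ _ = _
  have hfh' : dualAct (f : GL (Fin d) ℝ) ξ₀ = dualAct (h : GL (Fin d) ℝ) ξ₀ := hfh
  simp [dualAct_mul, ← hfh']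

/-- Properness of the dual action on the orbit. -/
lemma exists_isCompact_of_dualAct_mem (hH : IsClosed (H : Set (GL (Fin d) ℝ)))
    (hOpen : IsOpen (dualOrbit H ξ₀)) (hStab : IsCompact (dualStabilizer H ξ₀))
    {K : Set (EuclideanSpace ℝ (Fin d))} (hK : IsCompact K) (hKO : K ⊆ dualOrbit H ξ₀) :
    ∃ L : Set H, IsCompact L ∧ ∀ g : H, ∀ q ∈ K, dualAct (g : GL (Fin d) ℝ) q ∈ K → g ∈ L := by
  obtain ⟨F, hF, hKF⟩ := exists_isCompact_subset_image_dualAct hH hOpen hK hKO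
  -- For q = fᵀξ₀ one has gᵀq = (fg)ᵀξ₀ ∈ K, and g = f⁻¹(fg).
  refine ⟨F⁻¹ * _, hF.inv.mul (isCompact_setOf_dualAct_mem hH hOpen hStab hK hKO),
    fun g q hq hgq => ?_⟩
  obtain ⟨f, hf, rfl⟩ := hKF hq
  refine ⟨f⁻¹, by simpa using hf, f * g, ?_, by simp⟩
  simpa [dualAct_mul] using hgq

lemma zero_notMem_dualOrbit (hd : 0 < d) (hOpen : IsOpen (dualOrbit H ξ₀)) :
    (0 : EuclideanSpace ℝ (Fin d)) ∉ dualOrbit H ξ₀ := by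
  intro h0
  have : Nonempty (Fin d) := ⟨⟨0, hd⟩⟩
  have hz : ∀ h : GL (Fin d) ℝ, dualAct h (0 : EuclideanSpace ℝ (Fin d)) = 0 :=
    fun h => map_zero (dualActCLM h)
  have : dualOrbit H ξ₀ ⊆ {0} := fun η hη => by
    obtain ⟨h, rfl⟩ := exists_dualAct_eq h0 hη
    exact hz _
  have h2 : dualOrbit H ξ₀ = {0} := this.antisymm (by simpa using h0)
  rw [h2] at hOpen
  exact not_isOpen_singleton _ hOpen

/-- If H were compact, the orbit would be clopen and nonempty in a connected space, hence
everything. But 0 is fixed by the action, so it cannot belong to an open orbit when d ≥ 1. -/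
lemma noncompactSpace_of_isOpen_dualOrbit (hd : 0 < d) (hOpen : IsOpen (dualOrbit H ξ₀)) :
    NoncompactSpace H := by
  rw [← not_compactSpace_iff]
  intro hc
  have h1 : IsCompact (dualOrbit H ξ₀) := isCompact_range (continuous_dualAct_left H ξ₀)
  have h2 : IsClopen (dualOrbit H ξ₀) := ⟨h1.isClosed, hOpen⟩
  have h3 := h2.eq_univ ⟨ξ₀, mem_dualOrbit_self⟩
  exact zero_notMem_dualOrbit hd hOpen (h3 ▸ Set.mem_univ _)

end DualAction

end

/-! ### Well-spread families -/

lemma disjointTranslates_subset {G I : Type*} [Group G] (h : I → G) (U : Set G) (e : ℕ ≃ I) (i : I) :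
    disjointTranslates h U e i ⊆ h i • U := Set.sdiff_subset

section WellSpread

variable {G I : Type*} [Group G] [TopologicalSpace G] [IsTopologicalGroup G] {g : I → G}

/-- Disjoint nonempty open sets in a second countable space form a countable family. -/
lemma IsSeparatedFamily.countable [SecondCountableTopology G] (hg : IsSeparatedFamily g) :
    Countable I := by
  obtain ⟨V, hV, hgV⟩ := hg
  have h1 : (Set.univ : Set I).PairwiseDisjoint fun i => g i • interior V := fun i _ j _ hij =>
    (hgV i j hij).mono (Set.smul_set_mono interior_subset) (Set.smul_set_mono interior_subset)
  rw [← Set.countable_univ_iff]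
  exact h1.countable_of_isOpen (fun i _ => isOpen_interior.smul _)
    fun i _ => Set.Nonempty.smul_set ⟨1, mem_interior_iff_mem_nhds.2 hV⟩

lemma IsWellSpread.infinite [NoncompactSpace G] [T2Space G] (hg : IsWellSpread g) :
    Infinite I := by
  obtain ⟨-, W, -, hWc, hgW⟩ := hg
  by_contra hI
  have : Finite I := not_infinite_iff_finite.1 hI
  refine noncompact_univ G ?_
  have h1 : IsCompact (⋃ i, g i • closure W) := isCompact_iUnion fun i => hWc.smul (g i)
  convert h1
  refine (Set.univ_subset_iff.1 ?_).symm
  rw [← hgW]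
  exact Set.iUnion_mono fun i => Set.smul_set_mono subset_closure

/-- A packing bound: for the counted j, the sets (g_i⁻¹g_j)W are disjoint, have the same finite
positive measure μ(W), and all lie in the compact set LC. -/
lemma IsSeparatedFamily.exists_encard_le [LocallyCompactSpace G] [MeasurableSpace G]
    [BorelSpace G] (μ : Measure G) [μ.IsHaarMeasure] (hg : IsSeparatedFamily g) {L : Set G}
    (hL : IsCompact L) : ∃ n : ℕ, ∀ i, {j | (g i)⁻¹ * g j ∈ L}.encard ≤ n := by
  obtain ⟨V, hV, hgV⟩ := hg
  obtain ⟨C, hC, hC1⟩ := exists_compact_mem_nhds (1 : G)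
  set W := interior (V ∩ C) with hW
  have hWo : IsOpen W := isOpen_interior
  have hW1 : (1 : G) ∈ W := mem_interior_iff_mem_nhds.2 (Filter.inter_mem hV hC1)
  have hWV : W ⊆ V := interior_subset.trans Set.inter_subset_left
  have hWC : W ⊆ C := interior_subset.trans Set.inter_subset_right
  have hpos : μ W ≠ 0 := (hWo.measure_pos μ ⟨1, hW1⟩).ne'
  have hfin : μ W ≠ ⊤ := ((measure_mono hWC).trans_lt hC.measure_lt_top).ne
  have hLC : μ (L * C) ≠ ⊤ := (hL.mul hC).measure_lt_top.ne
  -- Any n > μ(LC)/μ(W) works: already n indices would give nμ(W) ≤ μ(LC). Choosing exactly n of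
  -- them below also covers infinite clusters.
  obtain ⟨n, hn⟩ := ENNReal.exists_nat_gt (ENNReal.div_lt_top hLC hpos).ne
  refine ⟨n, fun i => ?_⟩
  by_contra! hlt
  obtain ⟨t, htS, htn⟩ := Set.exists_subset_encard_eq hlt.le
  have htf : t.Finite := Set.finite_of_encard_eq_coe htn
  lift t to Finset I using htf
  rw [Set.encard_coe_eq_coe_finsetCard] at htn
  have hdisj : (t : Set I).PairwiseDisjoint fun j => ((g i)⁻¹ * g j) • W := fun j _ k _ hjk => by
    simp only [Function.onFun, mul_smul]
    exact Set.disjoint_smul_set.2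
      ((hgV j k hjk).mono (Set.smul_set_mono hWV) (Set.smul_set_mono hWV))
  have hsub : (⋃ j ∈ t, ((g i)⁻¹ * g j) • W) ⊆ L * C := by
    refine Set.iUnion₂_subset fun j hj => ?_
    rintro _ ⟨w, hw, rfl⟩
    exact Set.mul_mem_mul (htS hj) (hWC hw)
  have hsum := measure_biUnion_finset (μ := μ) hdisj fun j _ => (hWo.smul _).measurableSet
  simp only [measure_smul, Finset.sum_const, nsmul_eq_mul] at hsum
  have hle : (n : ENNReal) * μ W ≤ μ (L * C) := by
    rw [show (n : ENNReal) = (t.card : ENNReal) by exact_mod_cast htn.symm, ← hsum]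
    exact measure_mono hsub
  exact absurd (((ENNReal.le_div_iff_mul_le (Or.inl hpos) (Or.inl hfin)).2 hle).trans_lt hn)
    (lt_irrefl _)

lemma isMeasurablePartition_disjointTranslates [MeasurableSpace G] [BorelSpace G] {h : I → G}
    {U : Set G} (hUm : MeasurableSet U) (hU : IsUDense h U) (e : ℕ ≃ I) :
    IsMeasurablePartition (disjointTranslates h U e) where
  measurableSet i := (hUm.const_smul _).diff (MeasurableSet.iUnion fun m => hUm.const_smul _)
  disjoint i j hij := by
    have key : ∀ i j : I, e.symm i < e.symm j →
        Disjoint (disjointTranslates h U e i) (disjointTranslates h U e j) := fun i j hlt => by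
      rw [Set.disjoint_left]
      rintro x ⟨hx, -⟩ ⟨-, hx'⟩
      exact hx' (Set.mem_iUnion.2 ⟨⟨e.symm i, hlt⟩, by simpa using hx⟩)
    rcases lt_or_gt_of_ne (e.symm.injective.ne hij) with hlt | hlt
    · exact key i j hlt
    · exact (key j i hlt).symm
  iUnion_eq := by
    refine Set.eq_univ_of_forall fun x => ?_
    have hex : ∃ n, x ∈ h (e n) • U := by
      obtain ⟨i, hi⟩ := Set.mem_iUnion.1 (hU.symm ▸ Set.mem_univ x : x ∈ ⋃ i, h i • U)
      exact ⟨e.symm i, by simpa using hi⟩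
    classical
    -- The piece containing x is the one whose translate is the first in the enumeration to contain
    -- x.
    refine Set.mem_iUnion.2 ⟨e (Nat.find hex), Nat.find_spec hex, fun hx => ?_⟩
    obtain ⟨⟨m, hm⟩, hxm⟩ := Set.mem_iUnion.1 hx
    exact Nat.find_min hex (by simpa using hm) hxm

end WellSpread

/-! ### The induced covering -/

section Covering

variable {d : ℕ} {H : Subgroup (GL (Fin d) ℝ)} {ξ₀ : EuclideanSpace ℝ (Fin d)}

lemma isOpen_frequencySet (U : Set H) {ψ : EuclideanSpace ℝ (Fin d) → ℂ}
    (hψ : Continuous (𝓕 ψ)) : IsOpen (frequencySet U ψ) := by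
  rw [frequencySet, ← Set.iUnion_image_left]
  exact isOpen_biUnion fun u _ => isOpenMap_dualAct _ _ (isOpen_ne_fun hψ continuous_const)

/-- The compact set `K⁻ᵀ S`. -/
lemma isCompact_image2_dualAct_inv {K : Set H} (hK : IsCompact K)
    {S : Set (EuclideanSpace ℝ (Fin d))} (hS : IsCompact S) :
    IsCompact (Set.image2 (fun (h : H) ξ => dualAct ((h : GL (Fin d) ℝ)⁻¹) ξ) K S) := by
  rw [← Set.image_prod]
  refine (hK.prod hS).image ?_
  exact (continuous_dualAct_subgroup H).comp
    (f := fun p : H × EuclideanSpace ℝ (Fin d) => (p.1⁻¹, p.2))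
    (continuous_fst.inv.prodMk continuous_snd)

lemma image2_dualAct_inv_subset (K : Set H) {S : Set (EuclideanSpace ℝ (Fin d))}
    (hS : S ⊆ dualOrbit H ξ₀) :
    Set.image2 (fun (h : H) ξ => dualAct ((h : GL (Fin d) ℝ)⁻¹) ξ) K S ⊆ dualOrbit H ξ₀ := by
  rintro _ ⟨k, -, s, hs, rfl⟩
  simpa using dualAct_mem_dualOrbit k⁻¹ (hS hs)

lemma closure_frequencySet_subset {U : Set H} (hUc : IsCompact (closure U))
    {ψ : EuclideanSpace ℝ (Fin d) → ℂ} (hψ : IsTestFunctionOn (dualOrbit H ξ₀) (𝓕 ψ)) :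
    closure (frequencySet U ψ) ⊆
      Set.image2 (fun (h : H) ξ => dualAct ((h : GL (Fin d) ℝ)⁻¹) ξ) (closure U)
        (tsupport (𝓕 ψ)) :=
  closure_minimal (Set.image2_subset subset_closure subset_closure)
    (isCompact_image2_dualAct_inv hUc hψ.hasCompactSupport.isCompact).isClosed

lemma isInducedCovering_frequencySet {I : Type*} {h : I → H} (hh : IsWellSpread h)
    {U : Set H} (hUc : IsCompact (closure U)) (hU : IsUDense h U)
    {ψ : EuclideanSpace ℝ (Fin d) → ℂ} (hψ : IsTestFunctionOn (dualOrbit H ξ₀) (𝓕 ψ))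
    (hne : ∃ ξ, 𝓕 ψ ξ ≠ 0) : IsInducedCovering H ξ₀ h (frequencySet U ψ) where
  isWellSpread := hh
  isCompact_closure :=
    (isCompact_image2_dualAct_inv hUc hψ.hasCompactSupport.isCompact).of_isClosed_subset
      isClosed_closure (closure_frequencySet_subset hUc hψ)
  closure_subset := (closure_frequencySet_subset hUc hψ).trans
    (image2_dualAct_inv_subset _ hψ.tsupport_subset)
  iUnion_eq := by
    refine Set.Subset.antisymm (Set.iUnion_subset fun i => ?_) fun ξ hξ => ?_
    · rintro _ ⟨q, hq, rfl⟩
      simpa using dualAct_mem_dualOrbit (h i)⁻¹ (image2_dualAct_inv_subset U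
        ((subset_tsupport _).trans hψ.tsupport_subset) hq)
    · obtain ⟨η, hη⟩ := hne
      obtain ⟨g, rfl⟩ := exists_dualAct_eq (hψ.tsupport_subset (subset_tsupport _ hη)) hξ
      -- With ξ = gᵀη, the density is applied to g⁻¹ = h_i u, which gives ξ = h_i⁻ᵀ(u⁻ᵀη).
      obtain ⟨i, u, hu, hiu⟩ := Set.mem_iUnion.1
        (hU.symm ▸ Set.mem_univ g⁻¹ : g⁻¹ ∈ ⋃ i, h i • U)
      refine Set.mem_iUnion.2 ⟨i, dualAct ((u : GL (Fin d) ℝ)⁻¹) η, ⟨u, hu, η, hη, rfl⟩, ?_⟩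
      have hg : g = (h i * u)⁻¹ := inv_eq_iff_eq_inv.1 hiu.symm
      simp [hg, dualAct_mul]

/-- If h_j⁻ᵀq = h_i⁻ᵀq', then (h_i⁻¹h_j)ᵀq' = q, so properness confines h_i⁻¹h_j to one compact set
and the packing bound applies. -/
lemma isAdmissibleCovering_of_isInducedCovering (hH : IsClosed (H : Set (GL (Fin d) ℝ)))
    [MeasurableSpace H] [BorelSpace H] (μ : Measure H) [μ.IsHaarMeasure]
    (hOpen : IsOpen (dualOrbit H ξ₀)) (hStab : IsCompact (dualStabilizer H ξ₀))
    {I : Type*} {h : I → H} {Q : Set (EuclideanSpace ℝ (Fin d))}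
    (hQ : IsInducedCovering H ξ₀ h Q) :
    IsAdmissibleCovering (dualOrbit H ξ₀) (dualTranslates h Q) where
  nonempty := ⟨ξ₀, mem_dualOrbit_self⟩
  iUnion_eq := hQ.iUnion_eq
  exists_encard_le := by
    have := locallyCompactSpace_of_isClosed hH
    obtain ⟨L, hL, hLQ⟩ := exists_isCompact_of_dualAct_mem hH hOpen hStab hQ.isCompact_closure
      hQ.closure_subset
    obtain ⟨n, hn⟩ := hQ.isWellSpread.1.exists_encard_le μ hL
    refine ⟨n, fun i => (Set.encard_le_encard ?_).trans (hn i)⟩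
    rintro j ⟨_, ⟨q, hq, rfl⟩, q', hq', hqq⟩
    refine hLQ ((h i)⁻¹ * h j) q' (subset_closure hq') ?_
    simp only [Subgroup.coe_mul, Subgroup.coe_inv, dualAct_mul, hqq, dualAct_dualAct_inv]
    exact subset_closure hq

end Covering

/-! ### Smoothness of parametric integrals -/

section ParametricIntegral

lemma Continuous.integrableOn_of_subset_isCompact {X F : Type*} [TopologicalSpace X]
    [MeasurableSpace X] [OpensMeasurableSpace X] [NormedAddCommGroup F] {μ : Measure X}
    [IsFiniteMeasureOnCompacts μ] {K V : Set X} {f : X → F} (hf : Continuous f)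
    (hK : IsCompact K) (hKm : MeasurableSet K) (hVK : V ⊆ K) : IntegrableOn f V μ :=
  (hf.continuousOn.integrableOn_compact' hK hKm).mono_set hVK

universe u

variable {X : Type*} [TopologicalSpace X] [MeasurableSpace X] [OpensMeasurableSpace X]
  {P : Type*} [NormedAddCommGroup P] [NormedSpace ℝ P]
  {E : Type u} [NormedAddCommGroup E] [NormedSpace ℝ E] [ProperSpace E]

/-- The integration variable enters only through a continuous map `a` into a normed space, so no
smooth structure on `X` is needed. The derivative is again an integral of this form, which allows
iteration. -/
lemma hasFDerivAt_setIntegral_of_contDiff {F : Type*} [NormedAddCommGroup F] [NormedSpace ℝ F]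
    {μ : Measure X} [IsFiniteMeasureOnCompacts μ] {K V : Set X} (hK : IsCompact K)
    (hKm : MeasurableSet K) (hV : MeasurableSet V) (hVK : V ⊆ K) {a : X → P} (ha : Continuous a)
    {Φ : P × E → F} (hΦ : ContDiff ℝ ∞ Φ) (x₀ : E) :
    HasFDerivAt (fun x => ∫ t in V, Φ (a t, x) ∂μ)
      (∫ t in V, (fderiv ℝ Φ (a t, x₀)).comp (ContinuousLinearMap.inr ℝ P E) ∂μ) x₀ := by
  have hΦ' : Continuous fun p : X × E =>
      (fderiv ℝ Φ (a p.1, p.2)).comp (ContinuousLinearMap.inr ℝ P E) :=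
    ((hΦ.continuous_fderiv (by simp)).comp
      ((ha.comp continuous_fst).prodMk continuous_snd)).clm_comp continuous_const
  -- A constant dominates the partial derivative on K times the unit ball about x₀, and constants
  -- are integrable over V ⊆ K.
  obtain ⟨C, hC⟩ := (hK.prod (isCompact_closedBall x₀ 1)).exists_bound_of_continuousOn
    hΦ'.continuousOn
  refine hasFDerivAt_integral_of_dominated_of_fderiv_le (bound := fun _ => C)
    (Metric.closedBall_mem_nhds x₀ one_pos)
    (F' := fun x t => (fderiv ℝ Φ (a t, x)).comp (ContinuousLinearMap.inr ℝ P E))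
    (Filter.Eventually.of_forall fun x => (Continuous.integrableOn_of_subset_isCompact (μ := μ) ?_ hK hKm hVK).aestronglyMeasurable) (Continuous.integrableOn_of_subset_isCompact (μ := μ) ?_ hK hKm hVK)
    (Continuous.integrableOn_of_subset_isCompact (μ := μ) ?_ hK hKm hVK).aestronglyMeasurable ?_ (continuous_const.integrableOn_of_subset_isCompact hK hKm hVK) ?_
  · exact hΦ.continuous.comp (ha.prodMk continuous_const)
  · exact hΦ.continuous.comp (ha.prodMk continuous_const)
  · exact hΦ'.comp (continuous_id.prodMk continuous_const)
  · filter_upwards [ae_restrict_mem hV] with t ht x hx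
    exact hC (t, x) ⟨hVK ht, hx⟩
  · refine Filter.Eventually.of_forall fun t x _ => ?_
    exact ((hΦ.differentiable (by simp)) (a t, x)).hasFDerivAt.comp x (hasFDerivAt_prodMk_right _ _)

/-- The induction passes from `F` to `E →L[ℝ] F`, so `F` is quantified after `n` and shares the
universe of `E`. -/
lemma contDiff_nat_setIntegral {μ : Measure X} [IsFiniteMeasureOnCompacts μ] {K V : Set X}
    (hK : IsCompact K) (hKm : MeasurableSet K) (hV : MeasurableSet V) (hVK : V ⊆ K) {a : X → P}
    (ha : Continuous a) (n : ℕ) :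
    ∀ {F : Type u} [NormedAddCommGroup F] [NormedSpace ℝ F] {Φ : P × E → F}, ContDiff ℝ ∞ Φ →
      ContDiff ℝ n fun x => ∫ t in V, Φ (a t, x) ∂μ := by
  induction n with
  | zero =>
    intro F _ _ Φ hΦ
    exact contDiff_zero.2 (continuous_iff_continuousAt.2 fun x =>
      (hasFDerivAt_setIntegral_of_contDiff hK hKm hV hVK ha hΦ x).continuousAt)
  | succ n ih =>
    intro F _ _ Φ hΦ
    refine contDiff_succ_iff_hasFDerivAt.2 ⟨_, ih
      (Φ := fun p => (fderiv ℝ Φ p).comp (ContinuousLinearMap.inr ℝ P E)) ?_,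
      fun x => hasFDerivAt_setIntegral_of_contDiff hK hKm hV hVK ha hΦ x⟩
    exact (hΦ.fderiv_right (m := ∞) (by simp)).clm_comp contDiff_const

lemma contDiff_setIntegral {F : Type u} [NormedAddCommGroup F] [NormedSpace ℝ F]
    {μ : Measure X} [IsFiniteMeasureOnCompacts μ] {K V : Set X}
    (hK : IsCompact K) (hKm : MeasurableSet K) (hV : MeasurableSet V) (hVK : V ⊆ K) {a : X → P}
    (ha : Continuous a) {Φ : P × E → F} (hΦ : ContDiff ℝ ∞ Φ) :
    ContDiff ℝ ∞ fun x => ∫ t in V, Φ (a t, x) ∂μ :=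
  contDiff_infty.2 fun n => contDiff_nat_setIntegral hK hKm hV hVK ha n hΦ

end ParametricIntegral

/-! ### Linear changes of variables and Fourier transforms -/

section ChangeOfVariables

variable {d : ℕ}

lemma inner_matAct (A : Matrix (Fin d) (Fin d) ℝ) (x y : EuclideanSpace ℝ (Fin d)) :
    inner ℝ (matAct A x) y = inner ℝ x (matAct Aᵀ y) := by
  simp only [matAct, EuclideanSpace.inner_eq_star_dotProduct, star_trivial]
  rw [Matrix.dotProduct_mulVec, Matrix.mulVec_transpose]

lemma map_dualAct_volume (h : GL (Fin d) ℝ) :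
    (volume : Measure (EuclideanSpace ℝ (Fin d))).map (dualAct h) =
      ENNReal.ofReal |(h : Matrix (Fin d) (Fin d) ℝ).det|⁻¹ • volume := by
  have hdet : LinearMap.det (dualActCLM h : EuclideanSpace ℝ (Fin d) →ₗ[ℝ] _) =
      (h : Matrix (Fin d) (Fin d) ℝ).det := by
    rw [← Matrix.det_transpose (h : Matrix (Fin d) (Fin d) ℝ)]
    exact LinearMap.det_toLin (PiLp.basisFun 2 ℝ (Fin d)) _
  have := Measure.map_linearMap_addHaar_eq_smul_addHaar
    (volume : Measure (EuclideanSpace ℝ (Fin d)))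
    (f := (dualActCLM h : EuclideanSpace ℝ (Fin d) →ₗ[ℝ] _)) (by rw [hdet]; exact det_coe_ne_zero h)
  rw [hdet, abs_inv] at this
  exact this

lemma integral_comp_dualAct {F : Type*} [NormedAddCommGroup F] [NormedSpace ℝ F]
    (h : GL (Fin d) ℝ) (f : EuclideanSpace ℝ (Fin d) → F) :
    ∫ ξ, f (dualAct h ξ) = |(h : Matrix (Fin d) (Fin d) ℝ).det|⁻¹ • ∫ ξ, f ξ := by
  have := (dualActHomeomorph h).isClosedEmbedding.measurableEmbedding.integral_map
    (μ := volume) f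
  rw [show ⇑(dualActHomeomorph h) = dualAct h from rfl, map_dualAct_volume, integral_smul_measure,
    ENNReal.toReal_ofReal (by positivity)] at this
  exact this.symm

lemma lintegral_comp_dualAct (h : GL (Fin d) ℝ) (f : EuclideanSpace ℝ (Fin d) → ENNReal) :
    ∫⁻ ξ, f (dualAct h ξ) =
      ENNReal.ofReal |(h : Matrix (Fin d) (Fin d) ℝ).det|⁻¹ * ∫⁻ ξ, f ξ := by
  have := (dualActHomeomorph h).isClosedEmbedding.measurableEmbedding.lintegral_map
    (μ := volume) f
  rw [show ⇑(dualActHomeomorph h) = dualAct h from rfl, map_dualAct_volume,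
    lintegral_smul_measure, smul_eq_mul] at this
  exact this.symm

lemma integrable_comp_dualAct {F : Type*} [NormedAddCommGroup F] (h : GL (Fin d) ℝ)
    {f : EuclideanSpace ℝ (Fin d) → F} (hf : Integrable f) :
    Integrable fun ξ => f (dualAct h ξ) := by
  have := (dualActHomeomorph h).isClosedEmbedding.measurableEmbedding.integrable_map_iff
    (μ := volume) (g := f)
  rw [show ⇑(dualActHomeomorph h) = dualAct h from rfl, map_dualAct_volume] at this
  exact this.1 (hf.smul_measure ENNReal.ofReal_ne_top)

/-- The transpose of an invertible matrix. -/
def GL.transpose (h : GL (Fin d) ℝ) : GL (Fin d) ℝ :=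
  ⟨(h : Matrix (Fin d) (Fin d) ℝ)ᵀ, ((h⁻¹ : GL (Fin d) ℝ) : Matrix (Fin d) (Fin d) ℝ)ᵀ,
    by rw [← Matrix.transpose_mul]; simp, by rw [← Matrix.transpose_mul]; simp⟩

lemma matAct_eq_dualAct (h : GL (Fin d) ℝ) (x : EuclideanSpace ℝ (Fin d)) :
    matAct (h : Matrix (Fin d) (Fin d) ℝ) x = dualAct (GL.transpose h) x := by
  simp [dualAct, GL.transpose]

lemma det_inv_coe (h : GL (Fin d) ℝ) :
    ((h⁻¹ : GL (Fin d) ℝ) : Matrix (Fin d) (Fin d) ℝ).det =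
      (h : Matrix (Fin d) (Fin d) ℝ).det⁻¹ := by
  simp [Matrix.det_nonsing_inv]

lemma det_transpose_coe (h : GL (Fin d) ℝ) :
    (GL.transpose h : Matrix (Fin d) (Fin d) ℝ).det = (h : Matrix (Fin d) (Fin d) ℝ).det :=
  Matrix.det_transpose _

lemma integral_comp_matAct_inv {F : Type*} [NormedAddCommGroup F] [NormedSpace ℝ F]
    (h : GL (Fin d) ℝ) (f : EuclideanSpace ℝ (Fin d) → F) :
    ∫ x, f (matAct ((h⁻¹ : GL (Fin d) ℝ) : Matrix (Fin d) (Fin d) ℝ) x) =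
      |(h : Matrix (Fin d) (Fin d) ℝ).det| • ∫ x, f x := by
  simp_rw [matAct_eq_dualAct, integral_comp_dualAct, det_transpose_coe, det_inv_coe, abs_inv,
    inv_inv]

lemma lintegral_comp_matAct_inv (h : GL (Fin d) ℝ) (f : EuclideanSpace ℝ (Fin d) → ENNReal) :
    ∫⁻ x, f (matAct ((h⁻¹ : GL (Fin d) ℝ) : Matrix (Fin d) (Fin d) ℝ) x) =
      ENNReal.ofReal |(h : Matrix (Fin d) (Fin d) ℝ).det| * ∫⁻ x, f x := by
  simp_rw [matAct_eq_dualAct, lintegral_comp_dualAct, det_transpose_coe, det_inv_coe, abs_inv,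
    inv_inv]

lemma continuous_matAct_inv (H : Subgroup (GL (Fin d) ℝ)) :
    Continuous fun p : H × EuclideanSpace ℝ (Fin d) =>
      matAct (((p.1 : GL (Fin d) ℝ)⁻¹ : GL (Fin d) ℝ) : Matrix (Fin d) (Fin d) ℝ) p.2 := by
  have h1 : Continuous fun p : H × EuclideanSpace ℝ (Fin d) =>
      (((p.1 : GL (Fin d) ℝ)⁻¹ : GL (Fin d) ℝ) : Matrix (Fin d) (Fin d) ℝ) :=
    Units.continuous_val.comp ((continuous_subtype_val.comp continuous_fst).inv)
  exact (PiLp.continuous_toLp 2 _).comp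
    (h1.matrix_mulVec ((PiLp.continuous_ofLp 2 _).comp continuous_snd))

lemma matAct_inv_matAct (h : GL (Fin d) ℝ) (x : EuclideanSpace ℝ (Fin d)) :
    matAct (h : Matrix (Fin d) (Fin d) ℝ)
      (matAct ((h⁻¹ : GL (Fin d) ℝ) : Matrix (Fin d) (Fin d) ℝ) x) = x := by
  simp only [matAct, Matrix.mulVec_mulVec, ← Units.val_mul, mul_inv_cancel, Units.val_one,
    Matrix.one_mulVec]

lemma fourierInv_comp_dualAct (h : GL (Fin d) ℝ) (f : EuclideanSpace ℝ (Fin d) → ℂ)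
    (x : EuclideanSpace ℝ (Fin d)) :
    𝓕⁻ (fun ξ => f (dualAct h ξ)) x = ((|(h : Matrix (Fin d) (Fin d) ℝ).det|⁻¹ : ℝ) : ℂ) *
      𝓕⁻ f (matAct ((h⁻¹ : GL (Fin d) ℝ) : Matrix (Fin d) (Fin d) ℝ) x) := by
  rw [Real.fourierInv_eq, Real.fourierInv_eq]
  have := integral_comp_dualAct h fun η =>
    Real.fourierChar (inner ℝ η (matAct ((h⁻¹ : GL (Fin d) ℝ) : Matrix (Fin d) (Fin d) ℝ) x)) • f η
  rw [Complex.real_smul] at this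
  rw [← this]
  congr 1 with ξ
  rw [dualAct, inner_matAct, Matrix.transpose_transpose, matAct_inv_matAct]

/-- Translation becomes modulation, and the dilation contributes a Jacobian: |det h|^(-1/2) · |det
h| = |det h|^(1/2). -/
lemma fourier_quasiRegular (x : EuclideanSpace ℝ (Fin d)) (h : GL (Fin d) ℝ)
    (f : EuclideanSpace ℝ (Fin d) → ℂ) (ξ : EuclideanSpace ℝ (Fin d)) :
    𝓕 (quasiRegular x h f) ξ =
      ((|(h : Matrix (Fin d) (Fin d) ℝ).det| ^ (1 / 2 : ℝ) : ℝ) : ℂ) *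
        (Real.fourierChar (-inner ℝ x ξ) * 𝓕 f (dualAct h ξ)) := by
  set D := |(h : Matrix (Fin d) (Fin d) ℝ).det| with hD
  have hDpos : 0 < D := abs_pos.2 (det_coe_ne_zero h)
  have hDD : D ^ (-(1 / 2) : ℝ) * D = D ^ (1 / 2 : ℝ) := by
    nth_rewrite 2 [← Real.rpow_one D]
    rw [← Real.rpow_add hDpos]
    norm_num
  rw [Real.fourier_eq, Real.fourier_eq]
  rw [← integral_add_right_eq_self _ x]
  have e : ∀ y, Real.fourierChar (-inner ℝ (y + x) ξ) • quasiRegular x h f (y + x) =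
      (((D ^ (-(1 / 2) : ℝ) : ℝ) : ℂ) * Real.fourierChar (-inner ℝ x ξ)) *
      (fun z => Real.fourierChar (-inner ℝ z (dualAct h ξ)) • f z)
        (matAct ((h⁻¹ : GL (Fin d) ℝ) : Matrix (Fin d) (Fin d) ℝ) y) := by
    intro y
    have h1 : inner ℝ (matAct ((h⁻¹ : GL (Fin d) ℝ) : Matrix (Fin d) (Fin d) ℝ) y) (dualAct h ξ) =
        inner ℝ y ξ := by
      rw [dualAct, ← inner_matAct, matAct_inv_matAct]
    simp only [h1, quasiRegular, add_sub_cancel_right, Circle.smul_def, smul_eq_mul,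
      inner_add_left, neg_add, AddChar.map_add_eq_mul, Circle.coe_mul]
    ring
  simp_rw [e]
  rw [integral_const_mul, integral_comp_matAct_inv h
    (fun z => Real.fourierChar (-inner ℝ z (dualAct h ξ)) • f z), Complex.real_smul, ← hDD]
  push_cast
  ring

end ChangeOfVariables

/-! ### Plancherel identities for Schwartz functions -/

section Plancherel

variable {V : Type*} [NormedAddCommGroup V] [InnerProductSpace ℝ V] [FiniteDimensional ℝ V]
  [MeasurableSpace V] [BorelSpace V]

lemma SchwartzMap.integrable_norm_sq (f : 𝓢(V, ℂ)) : Integrable fun x => ‖f x‖ ^ 2 :=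
  (memLp_two_iff_integrable_sq_norm f.continuous.aestronglyMeasurable).1 (f.memLp 2 volume)

lemma lintegral_enorm_sq_eq {X : Type*} [MeasurableSpace X] {μ : Measure X} {f : X → ℂ}
    (hf : Integrable (fun x => ‖f x‖ ^ 2) μ) :
    ∫⁻ x, ‖f x‖ₑ ^ 2 ∂μ = ENNReal.ofReal (∫ x, ‖f x‖ ^ 2 ∂μ) := by
  rw [ofReal_integral_eq_lintegral_ofReal hf (Filter.Eventually.of_forall fun x => by positivity)]
  congr 1 with x
  rw [ENNReal.ofReal_pow (norm_nonneg _), ofReal_norm]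

lemma SchwartzMap.lintegral_enorm_sq_fourierInv (f : 𝓢(V, ℂ)) :
    ∫⁻ x, ‖𝓕⁻ (f : V → ℂ) x‖ₑ ^ 2 = ∫⁻ x, ‖f x‖ₑ ^ 2 := by
  have h1 := SchwartzMap.integral_norm_sq_fourier (𝓕⁻ f)
  rw [FourierTransform.fourier_fourierInv_eq] at h1
  rw [← SchwartzMap.fourierInv_coe, lintegral_enorm_sq_eq (𝓕⁻ f).integrable_norm_sq,
    lintegral_enorm_sq_eq f.integrable_norm_sq, h1]

/-- The Fourier integral is moved across the sesquilinear pairing of f with ĝ, and inversion is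
applied to ĝ. Only integrability of f is required, which suffices for f = π(x,h)ψ. -/
lemma integral_mul_star_eq_fourier (f : V → ℂ) (hf : Integrable f) (g : 𝓢(V, ℂ)) :
    ∫ x, g x * star (f x) = ∫ ξ, 𝓕 (g : V → ℂ) ξ * star (𝓕 f ξ) := by
  have := VectorFourier.integral_sesq_fourierIntegral_eq_neg_flip (innerSL ℂ) (L := innerₗ V)
    (μ := (volume : Measure V)) (ν := (volume : Measure V))
    Real.continuous_fourierChar continuous_inner hf (g := ((𝓕 g : 𝓢(V, ℂ)) : V → ℂ))
    (𝓕 g).integrable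
  -- The negated, flipped pairing turns the Fourier integral into the inverse one.
  have h2 : VectorFourier.fourierIntegral Real.fourierChar volume (-(innerₗ V).flip) 
      ((𝓕 g : 𝓢(V, ℂ)) : V → ℂ) = g := by
    have h3 : (𝓕⁻ ((𝓕 g : 𝓢(V, ℂ)) : V → ℂ)) = g := by
      rw [← SchwartzMap.fourierInv_coe, FourierTransform.fourierInv_fourier_eq]
    rw [← h3]
    ext x
    simp [Real.fourierInv_eq, VectorFourier.fourierIntegral, real_inner_comm]
  rw [h2] at this
  simp only [innerSL_apply_apply, RCLike.inner_apply] at this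
  exact this.symm

end Plancherel

/-! ### Supports of squared test functions -/

section TestFunction

variable {d : ℕ} {O : Set (EuclideanSpace ℝ (Fin d))} {f : EuclideanSpace ℝ (Fin d) → ℂ}

lemma IsTestFunctionOn.hasCompactSupport_norm_sq (hf : IsTestFunctionOn O f) :
    HasCompactSupport fun ξ => ‖f ξ‖ ^ 2 :=
  hf.hasCompactSupport.comp_left (g := fun z => ‖z‖ ^ 2) (by simp)

lemma IsTestFunctionOn.tsupport_norm_sq_subset (hf : IsTestFunctionOn O f) :
    tsupport (fun ξ => ‖f ξ‖ ^ 2) ⊆ O :=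
  (closure_mono (Function.support_comp_subset (g := fun z : ℂ => ‖z‖ ^ 2) (by simp) f)).trans
    hf.tsupport_subset

end TestFunction

/-! ### Integrals along the dual orbit -/

section OrbitIntegral

variable {d : ℕ} {H : Subgroup (GL (Fin d) ℝ)} {ξ₀ : EuclideanSpace ℝ (Fin d)}

lemma hasCompactSupport_comp_dualAct (hH : IsClosed (H : Set (GL (Fin d) ℝ)))
    (hOpen : IsOpen (dualOrbit H ξ₀)) (hStab : IsCompact (dualStabilizer H ξ₀))
    {F : EuclideanSpace ℝ (Fin d) → ℝ} (hFc : HasCompactSupport F)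
    (hFO : tsupport F ⊆ dualOrbit H ξ₀) :
    HasCompactSupport fun h : H => F (dualAct (h : GL (Fin d) ℝ) ξ₀) :=
  HasCompactSupport.intro (isCompact_setOf_dualAct_mem hH hOpen hStab hFc.isCompact hFO)
    fun _ hh => image_eq_zero_of_notMem_tsupport hh

variable [MeasurableSpace H] [BorelSpace H] (μ : Measure H) [μ.IsHaarMeasure]

lemma integrable_comp_dualAct_orbit (hH : IsClosed (H : Set (GL (Fin d) ℝ)))
    (hOpen : IsOpen (dualOrbit H ξ₀)) (hStab : IsCompact (dualStabilizer H ξ₀))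
    {F : EuclideanSpace ℝ (Fin d) → ℝ} (hF : Continuous F) (hFc : HasCompactSupport F)
    (hFO : tsupport F ⊆ dualOrbit H ξ₀) {ξ : EuclideanSpace ℝ (Fin d)}
    (hξ : ξ ∈ dualOrbit H ξ₀) :
    Integrable (fun h : H => F (dualAct (h : GL (Fin d) ℝ) ξ)) μ := by
  obtain ⟨g, rfl⟩ := hξ
  have h1 : Integrable (fun h : H => F (dualAct (h : GL (Fin d) ℝ) ξ₀)) μ :=
    (hF.comp (continuous_dualAct_left H ξ₀)).integrable_of_hasCompactSupport
      (hasCompactSupport_comp_dualAct hH hOpen hStab hFc hFO)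
  simpa [dualAct_mul] using h1.comp_mul_left g

/-- For ξ = gᵀξ₀ one has hᵀξ = (gh)ᵀξ₀, and left invariance absorbs g. -/
lemma integral_comp_dualAct_orbit (F : EuclideanSpace ℝ (Fin d) → ℝ)
    {ξ : EuclideanSpace ℝ (Fin d)} (hξ : ξ ∈ dualOrbit H ξ₀) :
    ∫ h : H, F (dualAct (h : GL (Fin d) ℝ) ξ) ∂μ =
      ∫ h : H, F (dualAct (h : GL (Fin d) ℝ) ξ₀) ∂μ := by
  obtain ⟨g, rfl⟩ := hξ
  rw [← integral_mul_left_eq_self (μ := μ) (fun h : H => F (dualAct (h : GL (Fin d) ℝ) ξ₀)) g]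
  simp [dualAct_mul]

lemma integral_comp_dualAct_orbit_pos (hH : IsClosed (H : Set (GL (Fin d) ℝ)))
    (hOpen : IsOpen (dualOrbit H ξ₀)) (hStab : IsCompact (dualStabilizer H ξ₀))
    {F : EuclideanSpace ℝ (Fin d) → ℝ} (hF : Continuous F) (hFc : HasCompactSupport F)
    (hFO : tsupport F ⊆ dualOrbit H ξ₀) (hF0 : 0 ≤ F) (hne : ∃ ξ, F ξ ≠ 0) :
    0 < ∫ h : H, F (dualAct (h : GL (Fin d) ℝ) ξ₀) ∂μ := by
  obtain ⟨ξ, hξ⟩ := hne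
  obtain ⟨g, hg⟩ := hFO (subset_tsupport _ hξ)
  refine (hF.comp (continuous_dualAct_left H ξ₀)).integral_pos_of_hasCompactSupport_nonneg_nonzero
    (hasCompactSupport_comp_dualAct hH hOpen hStab hFc hFO) (fun h => hF0 _) (x := g) ?_
  have hg' : dualAct (g : GL (Fin d) ℝ) ξ₀ = ξ := hg
  simpa [hg'] using hξ

end OrbitIntegral

/-! ### The wavelet transform -/

section Wavelet

variable {d : ℕ} {H : Subgroup (GL (Fin d) ℝ)} {ξ₀ : EuclideanSpace ℝ (Fin d)}

lemma continuous_quasiRegular {f : EuclideanSpace ℝ (Fin d) → ℂ} (hf : Continuous f) :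
    Continuous fun p : (EuclideanSpace ℝ (Fin d) × H) × EuclideanSpace ℝ (Fin d) =>
      quasiRegular p.1.1 (p.1.2 : GL (Fin d) ℝ) f p.2 := by
  refine Continuous.mul (Complex.continuous_ofReal.comp (Continuous.rpow_const ?_ ?_))
    (hf.comp ?_)
  · exact ((continuous_det_coe H).comp (continuous_snd.comp continuous_fst)).abs
  · exact fun p => Or.inl (abs_pos.2 (det_coe_ne_zero _)).ne'
  · exact (continuous_matAct_inv H).comp
      (f := fun p : (EuclideanSpace ℝ (Fin d) × H) × EuclideanSpace ℝ (Fin d) =>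
        (p.1.2, p.2 - p.1.1)) (by fun_prop)

/-- Joint continuity of the integrand already makes the parametric integral measurable. -/
lemma stronglyMeasurable_waveletTransform [MeasurableSpace H] [BorelSpace H]
    {g f : EuclideanSpace ℝ (Fin d) → ℂ} (hg : Continuous g) (hf : Continuous f) :
    StronglyMeasurable (waveletTransform H g f) := by
  have h1 : Continuous fun p : (EuclideanSpace ℝ (Fin d) × H) × EuclideanSpace ℝ (Fin d) =>
      f p.2 * star (quasiRegular p.1.1 (p.1.2 : GL (Fin d) ℝ) g p.2) :=
    (hf.comp continuous_snd).mul (continuous_quasiRegular hg).star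
  exact h1.stronglyMeasurable.integral_prod_right

lemma integrable_quasiRegular (x : EuclideanSpace ℝ (Fin d)) (h : GL (Fin d) ℝ)
    {f : EuclideanSpace ℝ (Fin d) → ℂ} (hf : Integrable f) : Integrable (quasiRegular x h f) := by
  have h1 : Integrable fun y =>
      f (matAct ((h⁻¹ : GL (Fin d) ℝ) : Matrix (Fin d) (Fin d) ℝ) y) := by
    simp_rw [matAct_eq_dualAct]
    exact integrable_comp_dualAct _ hf
  exact (h1.comp_sub_right x).const_mul _

/-- The frequency side of the wavelet transform at scale `h`. -/
lemma waveletTransform_eq (ψ : 𝓢(EuclideanSpace ℝ (Fin d), ℂ)) (x : EuclideanSpace ℝ (Fin d))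
    (h : H) :
    waveletTransform H ψ ψ (x, h) =
      ((|((h : GL (Fin d) ℝ) : Matrix (Fin d) (Fin d) ℝ).det| ^ (1 / 2 : ℝ) : ℝ) : ℂ) *
        𝓕⁻ (fun ξ => 𝓕 (ψ : EuclideanSpace ℝ (Fin d) → ℂ) ξ *
          star (𝓕 (ψ : EuclideanSpace ℝ (Fin d) → ℂ) (dualAct (h : GL (Fin d) ℝ) ξ))) x := by
  rw [waveletTransform, integral_mul_star_eq_fourier _ (integrable_quasiRegular x _ ψ.integrable),
    Real.fourierInv_eq, ← integral_const_mul]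
  congr 1 with ξ
  rw [fourier_quasiRegular, real_inner_comm ξ x, Circle.smul_def]
  simp only [star_mul', smul_eq_mul, Complex.star_def, Complex.conj_ofReal, AddChar.map_neg_eq_inv,
    Circle.coe_inv_eq_conj, Complex.conj_conj]
  ring

/-- Plancherel in x at fixed h. The factor |det h| will cancel the density |det h|⁻¹ of the Haar
measure of ℝᵈ ⋊ H. -/
lemma lintegral_waveletTransform (ψ : 𝓢(EuclideanSpace ℝ (Fin d), ℂ))
    (hψ : IsTestFunctionOn (dualOrbit H ξ₀) (𝓕 (ψ : EuclideanSpace ℝ (Fin d) → ℂ))) (h : H) :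
    ∫⁻ x, ‖waveletTransform H ψ ψ (x, h)‖ₑ ^ 2 =
      ENNReal.ofReal |((h : GL (Fin d) ℝ) : Matrix (Fin d) (Fin d) ℝ).det| *
        ∫⁻ ξ, ‖𝓕 (ψ : EuclideanSpace ℝ (Fin d) → ℂ) ξ‖ₑ ^ 2 *
          ‖𝓕 (ψ : EuclideanSpace ℝ (Fin d) → ℂ) (dualAct (h : GL (Fin d) ℝ) ξ)‖ₑ ^ 2 := by
  set D := |((h : GL (Fin d) ℝ) : Matrix (Fin d) (Fin d) ℝ).det| with hD
  have hD0 : 0 ≤ D := abs_nonneg _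
  have hc : HasCompactSupport fun ξ => 𝓕 (ψ : EuclideanSpace ℝ (Fin d) → ℂ) ξ *
      star (𝓕 (ψ : EuclideanSpace ℝ (Fin d) → ℂ) (dualAct (h : GL (Fin d) ℝ) ξ)) :=
    hψ.hasCompactSupport.mul_right
  have hs : ContDiff ℝ ∞ fun ξ => 𝓕 (ψ : EuclideanSpace ℝ (Fin d) → ℂ) ξ *
      star (𝓕 (ψ : EuclideanSpace ℝ (Fin d) → ℂ) (dualAct (h : GL (Fin d) ℝ) ξ)) :=
    hψ.contDiff.mul (Complex.conjCLE.contDiff.comp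
      (hψ.contDiff.comp (dualActCLM (h : GL (Fin d) ℝ)).contDiff))
  have h1 : ∫⁻ x, ‖𝓕⁻ (fun ξ => 𝓕 (ψ : EuclideanSpace ℝ (Fin d) → ℂ) ξ *
      star (𝓕 (ψ : EuclideanSpace ℝ (Fin d) → ℂ) (dualAct (h : GL (Fin d) ℝ) ξ))) x‖ₑ ^ 2 =
      ∫⁻ ξ, ‖𝓕 (ψ : EuclideanSpace ℝ (Fin d) → ℂ) ξ *
        star (𝓕 (ψ : EuclideanSpace ℝ (Fin d) → ℂ) (dualAct (h : GL (Fin d) ℝ) ξ))‖ₑ ^ 2 :=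
    SchwartzMap.lintegral_enorm_sq_fourierInv (hc.toSchwartzMap hs)
  have h2 : ‖((D ^ (1 / 2 : ℝ) : ℝ) : ℂ)‖ₑ ^ 2 = ENNReal.ofReal D := by
    rw [← ofReal_norm, Complex.norm_real, Real.norm_of_nonneg (by positivity),
      ← ENNReal.ofReal_pow (by positivity), ← Real.sqrt_eq_rpow, Real.sq_sqrt hD0]
  simp_rw [waveletTransform_eq, enorm_mul, mul_pow]
  rw [lintegral_const_mul' _ _ (by simp), h1, h2]
  simp_rw [enorm_mul, mul_pow, Complex.star_def, RCLike.enorm_conj]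

variable [MeasurableSpace H] [BorelSpace H] (μ : Measure H) [μ.IsHaarMeasure]

lemma lintegral_waveletTransform_semidirectHaar (hH : IsClosed (H : Set (GL (Fin d) ℝ)))
    (hOpen : IsOpen (dualOrbit H ξ₀)) (hStab : IsCompact (dualStabilizer H ξ₀))
    (ψ : 𝓢(EuclideanSpace ℝ (Fin d), ℂ))
    (hψ : IsTestFunctionOn (dualOrbit H ξ₀) (𝓕 (ψ : EuclideanSpace ℝ (Fin d) → ℂ))) :
    ∫⁻ p, ‖waveletTransform H ψ ψ p‖ₑ ^ 2 ∂(semidirectHaar μ) =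
      ENNReal.ofReal (∫ h : H, ‖𝓕 (ψ : EuclideanSpace ℝ (Fin d) → ℂ)
        (dualAct (h : GL (Fin d) ℝ) ξ₀)‖ ^ 2 ∂μ) * ENNReal.ofReal (∫ y, ‖ψ y‖ ^ 2) := by
  have := locallyCompactSpace_of_isClosed hH
  set f := 𝓕 (ψ : EuclideanSpace ℝ (Fin d) → ℂ) with hf
  set δ : H → ℝ := fun h => |((h : GL (Fin d) ℝ) : Matrix (Fin d) (Fin d) ℝ).det| with hδ
  have hδpos : ∀ h, 0 < δ h := fun h => abs_pos.2 (det_coe_ne_zero _)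
  have hfcont : Continuous f := hψ.contDiff.continuous
  have hmW := stronglyMeasurable_waveletTransform (H := H) ψ.continuous ψ.continuous
  have hδm : Measurable fun h : H => ENNReal.ofReal (|((h : GL (Fin d) ℝ) :
      Matrix (Fin d) (Fin d) ℝ).det|⁻¹) :=
    (continuous_det_coe H).abs.measurable.inv.ennreal_ofReal
  rw [semidirectHaar, lintegral_prod_symm _ (hmW.measurable.enorm.pow_const 2).aemeasurable,
    lintegral_withDensity_eq_lintegral_mul_non_measurable _ hδm (by simp)]
  have h1 : ∀ h : H, ((fun h : H => ENNReal.ofReal (|((h : GL (Fin d) ℝ) :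
      Matrix (Fin d) (Fin d) ℝ).det|⁻¹)) * fun h =>
        ∫⁻ x, ‖waveletTransform H ψ ψ (x, h)‖ₑ ^ 2) h =
      ∫⁻ ξ, ‖f ξ‖ₑ ^ 2 * ‖f (dualAct (h : GL (Fin d) ℝ) ξ)‖ₑ ^ 2 := fun h => by
    rw [Pi.mul_apply, lintegral_waveletTransform ψ hψ, ← mul_assoc,
      ← ENNReal.ofReal_mul (inv_nonneg.2 (hδpos h).le), inv_mul_cancel₀ (hδpos h).ne',
      ENNReal.ofReal_one, one_mul]
  simp_rw [h1]
  rw [lintegral_lintegral_swap]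
  swap
  · exact (((hfcont.measurable.comp measurable_snd).enorm.pow_const 2).mul
      ((hfcont.comp (continuous_dualAct_subgroup H)).measurable.enorm.pow_const 2)).aemeasurable
  have h2 : ∀ ξ, ∫⁻ h : H, ‖f ξ‖ₑ ^ 2 * ‖f (dualAct (h : GL (Fin d) ℝ) ξ)‖ₑ ^ 2 ∂μ =
      ‖f ξ‖ₑ ^ 2 * ENNReal.ofReal (∫ h : H, ‖f (dualAct (h : GL (Fin d) ℝ) ξ₀)‖ ^ 2 ∂μ) := by
    intro ξ
    rw [lintegral_const_mul' _ _ (by simp)]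
    -- Only ξ with ψ̂(ξ) ≠ 0 contribute; these lie in the orbit, where the inner integral is
    -- constant.
    by_cases hξ : f ξ = 0
    · simp [hξ]
    have hξO : ξ ∈ dualOrbit H ξ₀ := hψ.tsupport_subset (subset_tsupport _ hξ)
    rw [lintegral_enorm_sq_eq (integrable_comp_dualAct_orbit μ hH hOpen hStab
      (F := fun ξ => ‖f ξ‖ ^ 2)
      (hfcont.norm.pow 2) hψ.hasCompactSupport_norm_sq hψ.tsupport_norm_sq_subset hξO), integral_comp_dualAct_orbit μ (fun η => ‖f η‖ ^ 2) hξO]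
  simp_rw [h2]
  rw [lintegral_mul_const' _ _ ENNReal.ofReal_ne_top, mul_comm]
  congr 1
  have h3 := SchwartzMap.lintegral_enorm_sq_fourierInv (𝓕 ψ)
  rw [← SchwartzMap.fourierInv_coe, FourierTransform.fourierInv_fourier_eq,
    lintegral_enorm_sq_eq ψ.integrable_norm_sq] at h3
  exact h3.symm

lemma memLp_waveletTransform (hH : IsClosed (H : Set (GL (Fin d) ℝ)))
    (hOpen : IsOpen (dualOrbit H ξ₀)) (hStab : IsCompact (dualStabilizer H ξ₀))
    (ψ : 𝓢(EuclideanSpace ℝ (Fin d), ℂ))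
    (hψ : IsTestFunctionOn (dualOrbit H ξ₀) (𝓕 (ψ : EuclideanSpace ℝ (Fin d) → ℂ))) :
    MemLp (waveletTransform H ψ ψ) 2 (semidirectHaar μ) := by
  have hm := stronglyMeasurable_waveletTransform (H := H) ψ.continuous ψ.continuous
  refine (memLp_two_iff_integrable_sq_norm hm.aestronglyMeasurable).2
    ⟨(hm.norm.pow 2).aestronglyMeasurable, ?_⟩
  rw [hasFiniteIntegral_iff_enorm]
  simp_rw [enorm_pow, enorm_norm]
  rw [lintegral_waveletTransform_semidirectHaar μ hH hOpen hStab ψ hψ]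
  exact ENNReal.mul_lt_top ENNReal.ofReal_lt_top ENNReal.ofReal_lt_top

lemma waveletConst_eq (hH : IsClosed (H : Set (GL (Fin d) ℝ)))
    (hOpen : IsOpen (dualOrbit H ξ₀)) (hStab : IsCompact (dualStabilizer H ξ₀))
    (ψ : 𝓢(EuclideanSpace ℝ (Fin d), ℂ)) (hψ0 : ψ ≠ 0)
    (hψ : IsTestFunctionOn (dualOrbit H ξ₀) (𝓕 (ψ : EuclideanSpace ℝ (Fin d) → ℂ))) :
    waveletConst μ ψ = ∫ h : H, ‖𝓕 (ψ : EuclideanSpace ℝ (Fin d) → ℂ)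
        (dualAct (h : GL (Fin d) ℝ) ξ₀)‖ ^ 2 ∂μ := by
  have hm := memLp_waveletTransform μ hH hOpen hStab ψ hψ
  have hi := (memLp_two_iff_integrable_sq_norm hm.1).1 hm
  have h1 := lintegral_waveletTransform_semidirectHaar μ hH hOpen hStab ψ hψ
  have hc0 : 0 ≤ ∫ h : H, ‖𝓕 (ψ : EuclideanSpace ℝ (Fin d) → ℂ)
      (dualAct (h : GL (Fin d) ℝ) ξ₀)‖ ^ 2 ∂μ := integral_nonneg fun _ => by positivity
  have hψpos : 0 < ∫ y, ‖ψ y‖ ^ 2 := by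
    obtain ⟨x, hx⟩ : ∃ x, ψ x ≠ 0 := by
      by_contra! h0
      exact hψ0 (SchwartzMap.ext h0)
    exact integral_pos_of_integrable_nonneg_nonzero (x := x) (ψ.continuous.norm.pow 2)
      ψ.integrable_norm_sq (fun _ => by positivity) (by simpa using hx)
  rw [lintegral_enorm_sq_eq hi, ← ENNReal.ofReal_mul hc0,
    ENNReal.ofReal_eq_ofReal_iff (integral_nonneg fun _ => by positivity)
      (mul_nonneg hc0 hψpos.le)] at h1
  rw [waveletConst, h1, mul_div_cancel_right₀ _ hψpos.ne']

end Wavelet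

/-! ### The partition of unity -/

section PartitionOfUnity

variable {d : ℕ} {H : Subgroup (GL (Fin d) ℝ)} {ξ₀ : EuclideanSpace ℝ (Fin d)}

lemma frequencySet_smul {I : Type*} (h : I → H) (U : Set H) (ψ : EuclideanSpace ℝ (Fin d) → ℂ)
    (i : I) : frequencySet (h i • U) ψ = dualTranslates h (frequencySet U ψ) i := by
  rw [dualTranslates, frequencySet, frequencySet, Set.image_image2, ← Set.image_smul,
    Set.image2_image_left]
  simp [dualAct_mul]

variable [MeasurableSpace H] (μ : Measure H)

lemma mem_frequencySet_of_orbitBump_ne_zero {ψ : EuclideanSpace ℝ (Fin d) → ℂ} {V : Set H}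
    {ξ : EuclideanSpace ℝ (Fin d)} (hξ : orbitBump μ ψ V ξ ≠ 0) :
    ξ ∈ frequencySet V ψ := by
  by_contra hn
  refine hξ (setIntegral_eq_zero_of_forall_eq_zero fun g hg => ?_)
  by_contra h0
  exact hn ⟨g, hg, dualAct (g : GL (Fin d) ℝ) ξ, by simpa using h0, by simp⟩

variable [BorelSpace H]

/-- The group element enters as the linear map hᵀ; evaluation (A, ξ) ↦ Aξ is smooth, so the
parametric integral lemma applies. -/
lemma contDiff_orbitBump [IsFiniteMeasureOnCompacts μ] {ψ : EuclideanSpace ℝ (Fin d) → ℂ}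
    (hψ : ContDiff ℝ ∞ (𝓕 ψ)) {V : Set H} (hV : MeasurableSet V) (hVc : IsCompact (closure V)) :
    ContDiff ℝ ∞ (orbitBump μ ψ V) := by
  refine contDiff_setIntegral hVc isClosed_closure.measurableSet hV subset_closure
    (a := fun h : H => dualActCLM (h : GL (Fin d) ℝ))
    (continuous_dualActCLM.comp continuous_subtype_val)
    (Φ := fun p : (EuclideanSpace ℝ (Fin d) →L[ℝ] EuclideanSpace ℝ (Fin d)) ×
      EuclideanSpace ℝ (Fin d) => ‖𝓕 ψ (p.1 p.2)‖ ^ 2) ?_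
  exact (hψ.comp (contDiff_fst.clm_apply contDiff_snd)).norm_sq ℝ

lemma isTestFunctionOn_orbitBump [IsFiniteMeasureOnCompacts μ]
    {ψ : EuclideanSpace ℝ (Fin d) → ℂ} (hψ : IsTestFunctionOn (dualOrbit H ξ₀) (𝓕 ψ))
    {V : Set H} (hV : MeasurableSet V) (hVc : IsCompact (closure V)) (c : ℝ) :
    IsTestFunctionOn (dualOrbit H ξ₀) fun ξ => ((c * orbitBump μ ψ V ξ : ℝ) : ℂ) := by
  have hsub : tsupport (fun ξ => ((c * orbitBump μ ψ V ξ : ℝ) : ℂ)) ⊆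
      closure (frequencySet V ψ) := closure_mono fun ξ hξ => by
    refine mem_frequencySet_of_orbitBump_ne_zero μ fun h0 => hξ ?_
    simp [h0]
  have hsub' := hsub.trans (closure_frequencySet_subset hVc hψ)
  refine ⟨Complex.ofRealCLM.contDiff.comp
    (contDiff_const.mul (contDiff_orbitBump μ hψ.contDiff hV hVc)), ?_,
    hsub'.trans (image2_dualAct_inv_subset _ hψ.tsupport_subset)⟩
  exact (isCompact_image2_dualAct_inv hVc hψ.hasCompactSupport.isCompact).of_isClosed_subset
    (isClosed_tsupport _) hsub'

/-- Fubini applies because the continuous integrand vanishes, for h ∈ V, unless ξ lies in the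
compact set (closure V)⁻ᵀ supp F. -/
lemma fourierInv_setIntegral_comp_dualAct [SFinite μ] [IsFiniteMeasureOnCompacts μ]
    {F : EuclideanSpace ℝ (Fin d) → ℂ} (hF : Continuous F) (hFc : HasCompactSupport F)
    {V : Set H} (hV : MeasurableSet V) (hVc : IsCompact (closure V))
    (x : EuclideanSpace ℝ (Fin d)) :
    𝓕⁻ (fun ξ => ∫ h in V, F (dualAct (h : GL (Fin d) ℝ) ξ) ∂μ) x =
      ∫ h in V, 𝓕⁻ (fun ξ => F (dualAct (h : GL (Fin d) ℝ) ξ)) x ∂μ := by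
  simp_rw [Real.fourierInv_eq, Circle.smul_def, smul_eq_mul, ← integral_const_mul]
  refine integral_integral_swap ?_
  set S := Set.image2 (fun (h : H) ξ => dualAct ((h : GL (Fin d) ℝ)⁻¹) ξ) (closure V) (tsupport F)
    with hS
  have hSc : IsCompact S := isCompact_image2_dualAct_inv hVc hFc.isCompact
  have hcont : Continuous fun p : EuclideanSpace ℝ (Fin d) × H =>
      (Real.fourierChar (inner ℝ p.1 x) : ℂ) * F (dualAct (p.2 : GL (Fin d) ℝ) p.1) :=
    (continuous_subtype_val.comp (Real.continuous_fourierChar.comp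
      (continuous_fst.inner continuous_const))).mul
      (hF.comp ((continuous_dualAct_subgroup H).comp continuous_swap))
  have h1 : (volume : Measure (EuclideanSpace ℝ (Fin d))).prod (μ.restrict V) =
      (volume.prod μ).restrict (Set.univ ×ˢ V) := by
    rw [← Measure.prod_restrict, Measure.restrict_univ]
  rw [h1]
  refine IntegrableOn.of_forall_sdiff_eq_zero (s := S ×ˢ V)
    (hcont.integrableOn_of_subset_isCompact (hSc.prod hVc)
      (hSc.prod hVc).isClosed.measurableSet (Set.prod_mono_right subset_closure))
    (MeasurableSet.univ.prod hV) ?_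
  rintro ⟨ξ, h⟩ ⟨⟨-, hh⟩, hn⟩
  refine mul_eq_zero_of_right _ (image_eq_zero_of_notMem_tsupport fun hmem => hn ⟨?_, hh⟩)
  exact ⟨h, subset_closure hh, _, hmem, by simp⟩

/-- By Minkowski's integral inequality it is enough that every 𝓕⁻(F ∘ hᵀ) = |det h|⁻¹ (𝓕⁻F)(h⁻¹ ·)
has the L¹ norm of 𝓕⁻F. -/
lemma lintegral_enorm_fourierInv_setIntegral_le [SFinite μ] [IsFiniteMeasureOnCompacts μ]
    (F : 𝓢(EuclideanSpace ℝ (Fin d), ℂ)) (hFc : HasCompactSupport F) {V : Set H}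
    (hV : MeasurableSet V) (hVc : IsCompact (closure V)) :
    ∫⁻ x, ‖𝓕⁻ (fun ξ => ∫ h in V, F (dualAct (h : GL (Fin d) ℝ) ξ) ∂μ) x‖ₑ ≤
      μ V * ∫⁻ x, ‖𝓕⁻ (F : EuclideanSpace ℝ (Fin d) → ℂ) x‖ₑ := by
  have hgc : Continuous (𝓕⁻ (F : EuclideanSpace ℝ (Fin d) → ℂ)) := by
    rw [← SchwartzMap.fourierInv_coe]
    exact (𝓕⁻ F).continuous
  have hmeas : Continuous fun p : EuclideanSpace ℝ (Fin d) × H =>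
      ((|((p.2 : GL (Fin d) ℝ) : Matrix (Fin d) (Fin d) ℝ).det|⁻¹ : ℝ) : ℂ) *
        𝓕⁻ (F : EuclideanSpace ℝ (Fin d) → ℂ)
          (matAct (((p.2 : GL (Fin d) ℝ)⁻¹ : GL (Fin d) ℝ) : Matrix (Fin d) (Fin d) ℝ) p.1) :=
    (Complex.continuous_ofReal.comp (((continuous_det_coe H).comp continuous_snd).abs.inv₀
      fun p => (abs_pos.2 (det_coe_ne_zero _)).ne')).mul
      (hgc.comp ((continuous_matAct_inv H).comp continuous_swap))
  calc
    _ ≤ ∫⁻ x, ∫⁻ h in V, ‖𝓕⁻ (fun ξ => F (dualAct (h : GL (Fin d) ℝ) ξ)) x‖ₑ ∂μ := by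
      refine lintegral_mono fun x => ?_
      rw [fourierInv_setIntegral_comp_dualAct μ F.continuous hFc hV hVc x]
      exact enorm_integral_le_lintegral_enorm _
    _ = ∫⁻ h in V, (∫⁻ x, ‖𝓕⁻ (fun ξ => F (dualAct (h : GL (Fin d) ℝ) ξ)) x‖ₑ) ∂μ := by
      simp_rw [fourierInv_comp_dualAct]
      exact lintegral_lintegral_swap hmeas.enorm.measurable.aemeasurable
    _ = ∫⁻ _ in V, (∫⁻ x, ‖𝓕⁻ (F : EuclideanSpace ℝ (Fin d) → ℂ) x‖ₑ) ∂μ := by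
      congr 1 with h
      have hD : 0 < |((h : GL (Fin d) ℝ) : Matrix (Fin d) (Fin d) ℝ).det| :=
        abs_pos.2 (det_coe_ne_zero _)
      simp_rw [fourierInv_comp_dualAct, enorm_mul]
      rw [lintegral_const_mul' _ _ (by simp), lintegral_comp_matAct_inv (h : GL (Fin d) ℝ)
        (fun x => ‖𝓕⁻ (F : EuclideanSpace ℝ (Fin d) → ℂ) x‖ₑ), ← mul_assoc, ← ofReal_norm,
        Complex.norm_real, Real.norm_of_nonneg (inv_nonneg.2 hD.le),
        ← ENNReal.ofReal_mul (inv_nonneg.2 hD.le), inv_mul_cancel₀ hD.ne', ENNReal.ofReal_one,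
        one_mul]
    _ = _ := by rw [setLIntegral_const, mul_comm]

/-- The point is that B, the L¹ norm of 𝓕⁻(c|ψ̂|²), does not depend on V. It is finite because
c|ψ̂|² is smooth with compact support, hence Schwartz. -/
lemma exists_eLpNorm_fourierInv_orbitBump_le [SFinite μ] [IsFiniteMeasureOnCompacts μ]
    {ψ : EuclideanSpace ℝ (Fin d) → ℂ} (hψ : IsTestFunctionOn (dualOrbit H ξ₀) (𝓕 ψ)) (c : ℝ) :
    ∃ B : ENNReal, B < ⊤ ∧ ∀ V : Set H, MeasurableSet V → IsCompact (closure V) →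
      eLpNorm (𝓕⁻ fun ξ => ((c * orbitBump μ ψ V ξ : ℝ) : ℂ)) 1 volume ≤ μ V * B := by
  have hFs : ContDiff ℝ ∞ fun ξ => ((c * ‖𝓕 ψ ξ‖ ^ 2 : ℝ) : ℂ) :=
    Complex.ofRealCLM.contDiff.comp (contDiff_const.mul (hψ.contDiff.norm_sq ℝ))
  have hFc : HasCompactSupport fun ξ => ((c * ‖𝓕 ψ ξ‖ ^ 2 : ℝ) : ℂ) :=
    hψ.hasCompactSupport.comp_left (g := fun z : ℂ => ((c * ‖z‖ ^ 2 : ℝ) : ℂ)) (by simp)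
  set F := hFc.toSchwartzMap hFs with hF
  refine ⟨∫⁻ x, ‖𝓕⁻ (F : EuclideanSpace ℝ (Fin d) → ℂ) x‖ₑ, ?_, fun V hV hVc => ?_⟩
  · rw [← SchwartzMap.fourierInv_coe]
    exact (𝓕⁻ F).integrable.2
  · rw [eLpNorm_one_eq_lintegral_enorm]
    convert lintegral_enorm_fourierInv_setIntegral_le μ F hFc hV hVc using 5 with x
    ext ξ
    rw [orbitBump, ← integral_const_mul, ← integral_complex_ofReal]
    rfl

lemma hasSum_orbitBump [μ.IsHaarMeasure] (hH : IsClosed (H : Set (GL (Fin d) ℝ)))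
    (hOpen : IsOpen (dualOrbit H ξ₀)) (hStab : IsCompact (dualStabilizer H ξ₀))
    {ψ : EuclideanSpace ℝ (Fin d) → ℂ} (hψ : IsTestFunctionOn (dualOrbit H ξ₀) (𝓕 ψ))
    {I : Type*} [Countable I] {V : I → Set H} (hV : IsMeasurablePartition V)
    {ξ : EuclideanSpace ℝ (Fin d)} (hξ : ξ ∈ dualOrbit H ξ₀) :
    HasSum (fun i => orbitBump μ ψ (V i) ξ)
      (∫ h : H, ‖𝓕 ψ (dualAct (h : GL (Fin d) ℝ) ξ₀)‖ ^ 2 ∂μ) := by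
  have hint := integrable_comp_dualAct_orbit μ hH hOpen hStab (F := fun ξ => ‖𝓕 ψ ξ‖ ^ 2)
    (hψ.contDiff.continuous.norm.pow 2) hψ.hasCompactSupport_norm_sq hψ.tsupport_norm_sq_subset hξ
  have := hasSum_integral_iUnion hV.measurableSet (fun i j hij => hV.disjoint i j hij)
    hint.integrableOn
  rwa [hV.iUnion_eq, setIntegral_univ,
    integral_comp_dualAct_orbit μ (fun η => ‖𝓕 ψ η‖ ^ 2) hξ] at this

lemma isBAPU_orbitBump [μ.IsHaarMeasure] (hH : IsClosed (H : Set (GL (Fin d) ℝ)))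
    (hOpen : IsOpen (dualOrbit H ξ₀)) (hStab : IsCompact (dualStabilizer H ξ₀))
    {I : Type*} {h : I → H} (hh : IsWellSpread h) {U : Set H} (hUc : IsCompact (closure U))
    (hU : IsUDense h U) {ψ : EuclideanSpace ℝ (Fin d) → ℂ}
    (hψ : IsTestFunctionOn (dualOrbit H ξ₀) (𝓕 ψ)) (hne : ∃ ξ, 𝓕 ψ ξ ≠ 0) {C : ℝ}
    (hC : C = ∫ h : H, ‖𝓕 ψ (dualAct (h : GL (Fin d) ℝ) ξ₀)‖ ^ 2 ∂μ) (hC0 : C ≠ 0)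
    {V : I → Set H} (hV : IsMeasurablePartition V) (hVU : ∀ i, V i ⊆ h i • U) :
    IsBAPU (dualOrbit H ξ₀) (dualTranslates h (frequencySet U ψ))
      fun i ξ => ((C⁻¹ * orbitBump μ ψ (V i) ξ : ℝ) : ℂ) := by
  have := locallyCompactSpace_of_isClosed hH
  have := hh.1.countable
  have hVc : ∀ i, IsCompact (closure (V i)) := fun i => by
    refine (hUc.smul (h i)).of_isClosed_subset isClosed_closure ?_
    rw [← closure_smul]
    exact closure_mono (hVU i)
  refine ⟨hOpen, isAdmissibleCovering_of_isInducedCovering hH μ hOpen hStab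
    (isInducedCovering_frequencySet hh hUc hU hψ hne),
    fun i => isTestFunctionOn_orbitBump μ hψ (hV.measurableSet i) (hVc i) _,
    fun ξ hξ => ?_, fun i ξ hξ => ?_, ?_⟩
  · have h1 := (hasSum_orbitBump μ hH hOpen hStab hψ hV hξ).mul_left C⁻¹
    rw [← hC, inv_mul_cancel₀ hC0] at h1
    simpa using Complex.hasSum_ofReal.2 h1
  · by_contra h0
    have h1 : ξ ∈ frequencySet (V i) ψ :=
      mem_frequencySet_of_orbitBump_ne_zero μ fun h0' => h0 (by simp [h0'])
    refine hξ.2 ?_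
    rw [← frequencySet_smul]
    exact Set.image2_subset_right (hVU i) h1
  · obtain ⟨B, hB, hVB⟩ := exists_eLpNorm_fourierInv_orbitBump_le μ hψ C⁻¹
    have hμU : μ (closure U) < ⊤ := hUc.measure_lt_top
    refine lt_of_le_of_lt (iSup_le fun i => ?_) (ENNReal.mul_lt_top hμU hB)
    -- Left invariance bounds all μ(V i) by the single finite number μ(closure U).
    refine (hVB (V i) (hV.measurableSet i) (hVc i)).trans ?_
    refine mul_le_mul_left ?_ B
    calc μ (V i) ≤ μ (h i • U) := measure_mono (hVU i)
      _ = μ U := measure_smul _ _ _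
      _ ≤ μ (closure U) := measure_mono subset_closure

end PartitionOfUnity

/-! ### The main theorem -/

theorem mainTheorem7 {d : ℕ} (hd : 0 < d)
    (H : Subgroup (GL (Fin d) ℝ)) (hH : IsClosed (H : Set (GL (Fin d) ℝ)))
    [MeasurableSpace H] [BorelSpace H] (μ : Measure H) [μ.IsHaarMeasure]
    (ξ₀ : EuclideanSpace ℝ (Fin d))
    (hOpen : IsOpen (dualOrbit H ξ₀)) (hFull : volume (dualOrbit H ξ₀)ᶜ = 0)
    (hStab : IsCompact (dualStabilizer H ξ₀))
    {I : Type*} (h : I → H) (hh : IsWellSpread h)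
    (U : Set H) (hUc : IsCompact (closure U)) (hUm : MeasurableSet U) (hU : IsUDense h U)
    (ψ : 𝓢(EuclideanSpace ℝ (Fin d), ℂ)) (hψ : ψ ≠ 0)
    (hψO : IsTestFunctionOn (dualOrbit H ξ₀) (𝓕 (ψ : EuclideanSpace ℝ (Fin d) → ℂ))) :
    (Countable I ∧ Infinite I) ∧
    (∀ e : ℕ ≃ I, IsMeasurablePartition (disjointTranslates h U e) ∧
      ∀ i, disjointTranslates h U e i ⊆ h i • U) ∧
    (IsOpen (frequencySet U ψ) ∧
      IsInducedCovering H ξ₀ h (frequencySet U ψ)) ∧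
    (MemLp (waveletTransform H ψ ψ) 2 (semidirectHaar μ) ∧ 0 < waveletConst μ ψ) ∧
    (∀ V : I → Set H, IsMeasurablePartition V → (∀ i, V i ⊆ h i • U) →
      IsBAPU (dualOrbit H ξ₀) (dualTranslates h (frequencySet U ψ))
        (fun i ξ => (((waveletConst μ ψ)⁻¹ * orbitBump μ ψ (V i) ξ : ℝ) : ℂ))) := by
  have : LocallyCompactSpace H := locallyCompactSpace_of_isClosed hH
  have : NoncompactSpace H := noncompactSpace_of_isOpen_dualOrbit hd hOpen
  -- Fourier inversion: ψ̂ = 0 would force ψ = 0.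
  have hne : ∃ ξ, 𝓕 (ψ : EuclideanSpace ℝ (Fin d) → ℂ) ξ ≠ 0 := by
    by_contra! h0
    have h1 : 𝓕 ψ = 0 := SchwartzMap.ext h0
    have h2 : 𝓕⁻ (𝓕 ψ) = ψ := FourierTransform.fourierInv_fourier_eq ψ
    refine hψ (h2.symm.trans ?_)
    rw [h1, FourierTransform.fourierInv_zero]
  have hC := waveletConst_eq μ hH hOpen hStab ψ hψ hψO
  have hCpos : 0 < waveletConst μ ψ := by
    rw [hC]
    refine integral_comp_dualAct_orbit_pos μ hH hOpen hStab
      (F := fun ξ => ‖𝓕 (ψ : EuclideanSpace ℝ (Fin d) → ℂ) ξ‖ ^ 2)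
      (hψO.contDiff.continuous.norm.pow 2)
      hψO.hasCompactSupport_norm_sq hψO.tsupport_norm_sq_subset (fun ξ => by positivity)
      (by simpa using hne)
  exact ⟨⟨hh.1.countable, hh.infinite⟩,
    fun e => ⟨isMeasurablePartition_disjointTranslates hUm hU e, disjointTranslates_subset h U e⟩,
    ⟨isOpen_frequencySet U hψO.contDiff.continuous,
      isInducedCovering_frequencySet hh hUc hU hψO hne⟩,
    ⟨memLp_waveletTransform μ hH hOpen hStab ψ hψO, hCpos⟩,
    fun V hV hVU => isBAPU_orbitBump μ hH hOpen hStab hh hUc hU hψO hne hC hCpos.ne' hV hVU⟩
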